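/- **Theorem 2.1.** A map $E:\{\pm1\}^k\to\{\pm1\}^n$ is a $(q,\delta,\varepsilon)$-locally decodable code if there is a randomized (possibly adaptive) decoder $\mathrm{Dec}$ which, on input $i\in[k]$ and with oracle access to a word $y\in\{\pm1\}^n$, makes at most $q$ queries to $y$, and which satisfies $\Pr[\mathrm{Dec}^y(i)=b_i]\ge \frac12+\varepsilon$ for every $i\in[k]$, every message $b\in\{\pm1\}^k$ and every $y$ that differs from $E(b)$ in at most $\delta n$ coordinates. It is linear if it is $\mathbb F_2$-linear under the identification of $\{\pm1\}$ with $\mathbb F_2$, i.e. $E(ab)=E(a)E(b)$ for all $a,b\in\{\pm1\}^k$ (coordinatewise products). For every odd integer $q\ge 3$ there is a constant $C=C(q)>0$, depending only on $q$, such that for all integers $k\ge 0$ and $n\ge 2$, all real $\delta>0$ and $\varepsilon>0$, and every linear $(q,\delta,\varepsilon)$-locally decodable code $E:\{\pm1\}^k\to\{\pm1\}^n$, $$k\;\le\;\frac{C}{\delta}\, n^{1-2/q}\,(\log n)^2 .$$ -/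

import Mathlib

/-- A deterministic adaptive algorithm with oracle access to a word `y ∈ {±1}^n`: it either halts
with an output bit, or reads the coordinate `y v` and continues depending on the bit it sees.
The two-element group `ℤˣ` plays the role of `{±1}`. -/
inductive QueryAlg (n : ℕ) : Type
  | output (b : ℤˣ) : QueryAlg n
  | query (v : Fin n) (next : ℤˣ → QueryAlg n) : QueryAlg n

namespace QueryAlg

/-- The bit output by the algorithm when its oracle is `y`. -/
def run {n : ℕ} : QueryAlg n → (Fin n → ℤˣ) → ℤˣ
  | output b, _ => b
  | query v next, y => run (next (y v)) y

/-- The number of queries made by the algorithm when its oracle is `y`. -/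
def numQueries {n : ℕ} : QueryAlg n → (Fin n → ℤˣ) → ℕ
  | output _, _ => 0
  | query v next, y => numQueries (next (y v)) y + 1

end QueryAlg

/-- `E : {±1}^k → {±1}^n` is a `(q, δ, ε)`-locally decodable code. A randomized decoder is, for each
message index `i`, a probability distribution over deterministic adaptive query algorithms. It makes
at most `q` queries, and for every message `b` and every word `y` within Hamming distance `δ n` of
`E b` it outputs `b i` with probability at least `1/2 + ε`. -/
def IsLDC {k n : ℕ} (q : ℕ) (δ ε : ℝ) (E : (Fin k → ℤˣ) → (Fin n → ℤˣ)) : Prop :=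
  ∃ Dec : Fin k → PMF (QueryAlg n),
    (∀ i, ∀ A ∈ (Dec i).support, ∀ y, A.numQueries y ≤ q) ∧
    ∀ (i : Fin k) (b : Fin k → ℤˣ) (y : Fin n → ℤˣ), (hammingDist y (E b) : ℝ) ≤ δ * n →
      1 / 2 + ε ≤ (((Dec i).map fun A => A.run y) (b i)).toReal

/-- Linearity over `𝔽₂`, in multiplicative notation: under the identification of `𝔽₂` with `{±1}`,
addition of vectors becomes the coordinatewise product (and scalars in `𝔽₂` add no condition). -/
def IsLinearCode {k n : ℕ} (E : (Fin k → ℤˣ) → (Fin n → ℤˣ)) : Prop :=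
  ∀ a b, E (a * b) = E a * E b

/-! Linearity turns the decoder into combinatorics: every message index has a matching of at least
δn/q recovery sets of size at most q (`exists_matching_of_isLDC`). Otherwise erasing everything
covered by a maximal matching is an admissible corruption, after which no q-query output correlates
with the symbol.

It remains to bound the hyperedges of these k coloured matchings by O(nℓ log² n), with ℓ ≈
n^(1-2/q). Label positions by columns of the generator matrix, so the labels on a hyperedge of
colour j multiply to the basis vector e_j. If hyperedges of colours j < j' share a core of t
vertices, the core cancels and their other 2m = 2(q-t) vertices multiply to e_j e_j'. Such a pair
acts on the Kikuchi graph, whose vertices are m-tuples of ℓ-tuples: in each block an entry from one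
hyperedge is replaced by one from the other. Along such an edge the label first changes in
coordinate j, so edge isoperimetry in the cube (`card_mul_log_two_le`) bounds the edges by colour
degree times N log N. If the pairs overlap little, most edges have colour degrees of average order,
which yields `card_pairs_mul_log_two_le`.

Small overlap comes from working at one dyadic scale. With p = ℓ/n, if every nonempty R lies in at
most 2λ max(1, np^|R|) hyperedges, then groups of at least λ max(1, np^t) hyperedges with a common
t-core cover only O(nℓ log n) hyperedges (`IsGrouping.card_mul_le`). Deleting maximal groupings for
t = 1, ..., q halves λ. After log₂ n halvings vertex degrees are at most 2ℓ, so at most 2nℓ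
hyperedges remain. -/

section LinearLDC

open Finset

/-! ### From local decoders to matchings of recovery sets -/

/-- The positions in `R` determine the message symbol `i`. -/
def IsRecoverySet {k n : ℕ} (E : (Fin k → ℤˣ) → (Fin n → ℤˣ)) (i : Fin k) (R : Finset (Fin n)) :
    Prop :=
  ∀ b, ∏ j ∈ R, E b j = b i

theorem sum_units_eq_zero_of_map_mul {G : Type*} [Fintype G] [Group G] (χ : G → ℤˣ)
    (hmul : ∀ a b, χ (a * b) = χ a * χ b) (hne : ∃ a, χ a ≠ 1) : ∑ b, ((χ b : ℤˣ) : ℤ) = 0 := by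
  obtain ⟨a, ha⟩ := hne
  have h1 : χ a = -1 := (Int.units_eq_one_or _).resolve_left ha
  have h2 : ∑ b, ((χ b : ℤˣ) : ℤ) = ∑ b, ((χ (a * b) : ℤˣ) : ℤ) :=
    (Equiv.sum_comp (Equiv.mulLeft a) fun b => ((χ b : ℤˣ) : ℤ)).symm
  simp only [hmul, h1, Units.val_neg, neg_one_mul,
    Finset.sum_neg_distrib] at h2
  linarith

/-- The word obtained from `y` by erasing the coordinates in `T`. -/
def eraseWord {n : ℕ} (T : Finset (Fin n)) (y : Fin n → ℤˣ) : Fin n → ℤˣ :=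
  fun j => if j ∈ T then 1 else y j

/-- The summand is a character of the message group, since erased positions contribute 1. It is
trivial only if `S \ T` is a recovery set, and that set would avoid `T`. -/
theorem sum_coord_mul_prod_eraseWord {k n : ℕ} {E : (Fin k → ℤˣ) → (Fin n → ℤˣ)}
    (hE : IsLinearCode E) {i : Fin k} {q : ℕ} {T : Finset (Fin n)}
    (hT : ∀ R, #R ≤ q → IsRecoverySet E i R → ¬ Disjoint R T)
    (S : Finset (Fin n)) (hS : #S ≤ q) :
    ∑ b : Fin k → ℤˣ, ((b i * ∏ j ∈ S, eraseWord T (E b) j : ℤˣ) : ℤ) = 0 := by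
  have hprod : ∀ b, ∏ j ∈ S, eraseWord T (E b) j = ∏ j ∈ S \ T, E b j := by
    intro b
    rw [← Finset.filter_notMem_eq_sdiff, Finset.prod_filter]
    exact Finset.prod_congr rfl fun j _ => by by_cases h : j ∈ T <;> simp [eraseWord, h]
  refine sum_units_eq_zero_of_map_mul
    (fun b : Fin k → ℤˣ => b i * ∏ j ∈ S, eraseWord T (E b) j) ?_ ?_
  · intro a b
    rw [hprod, hprod, hprod, hE, Pi.mul_apply, mul_mul_mul_comm, ← Finset.prod_mul_distrib]
    rfl
  · by_contra! h
    refine hT (S \ T) ((card_le_card sdiff_subset).trans hS) ?_ disjoint_sdiff_self_left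
    intro b
    have := h b
    rw [hprod] at this
    rw [← mul_left_cancel_iff (a := b i), this, ← sq, Int.units_sq]

/-- Up to the factor 2^|F|, the indicator of a pattern is ∏ (1 + a_j y_j), which expands into
characters on subsets of `F`. -/
theorem sum_coord_mul_pattern {k n : ℕ} {E : (Fin k → ℤˣ) → (Fin n → ℤˣ)}
    (hE : IsLinearCode E) {i : Fin k} {q : ℕ} {T : Finset (Fin n)}
    (hT : ∀ R, #R ≤ q → IsRecoverySet E i R → ¬ Disjoint R T)
    (F : Finset (Fin n)) (hF : #F ≤ q) (a : Fin n → ℤˣ) :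
    ∑ b : Fin k → ℤˣ, (if ∀ j ∈ F, eraseWord T (E b) j = a j then ((b i : ℤˣ) : ℤ) else 0) = 0 := by
  have hind : ∀ b, (2 : ℤ) ^ #F *
      (if ∀ j ∈ F, eraseWord T (E b) j = a j then ((b i : ℤˣ) : ℤ) else 0) =
      (b i : ℤ) * ∏ j ∈ F, (1 + (a j : ℤ) * (eraseWord T (E b) j : ℤ)) := by
    intro b
    split_ifs with h
    · rw [mul_comm, Finset.prod_congr rfl (g := fun _ => (2 : ℤ)), Finset.prod_const]
      intro j hj
      rw [h j hj, ← Units.val_mul, ← sq, Int.units_sq]; rfl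
    · push Not at h
      obtain ⟨j, hj, hne⟩ := h
      rw [Finset.prod_eq_zero hj]
      · simp
      · rcases Int.units_eq_one_or (a j) with h1 | h1 <;>
          rcases Int.units_eq_one_or (eraseWord T (E b) j) with h2 | h2 <;> simp_all
  have h2 : (2 : ℤ) ^ #F * ∑ b : Fin k → ℤˣ,
      (if ∀ j ∈ F, eraseWord T (E b) j = a j then ((b i : ℤˣ) : ℤ) else 0) = 0 := by
    rw [Finset.mul_sum, Finset.sum_congr rfl fun b _ => hind b]
    simp_rw [Finset.prod_one_add, Finset.mul_sum]
    rw [Finset.sum_comm]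
    refine Finset.sum_eq_zero fun S hS => ?_
    have := sum_coord_mul_prod_eraseWord hE hT S
      ((card_le_card (Finset.mem_powerset.1 hS)).trans hF)
    have h3 : ∀ b : Fin k → ℤˣ, (b i : ℤ) * ∏ j ∈ S, ((a j : ℤ) * (eraseWord T (E b) j : ℤ)) =
        (∏ j ∈ S, (a j : ℤ)) * ((b i * ∏ j ∈ S, eraseWord T (E b) j : ℤˣ) : ℤ) := by
      intro b
      rw [Finset.prod_mul_distrib, Units.val_mul, Units.coe_prod]; ring
    rw [Finset.sum_congr rfl fun b _ => h3 b, ← Finset.mul_sum, this, mul_zero]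
  exact (mul_eq_zero.1 h2).resolve_left (by positivity)

/-- Induction along the decision tree: `F` and `a` record the positions read and the answers seen,
`m` the remaining budget. At a leaf the output is constant on the pattern. -/
theorem sum_coord_mul_run {k n : ℕ} {E : (Fin k → ℤˣ) → (Fin n → ℤˣ)}
    (hE : IsLinearCode E) {i : Fin k} {q : ℕ} {T : Finset (Fin n)}
    (hT : ∀ R, #R ≤ q → IsRecoverySet E i R → ¬ Disjoint R T) (A : QueryAlg n) :
    ∀ (m : ℕ) (F : Finset (Fin n)) (a : Fin n → ℤˣ), #F + m ≤ q →
      (∀ y, (∀ j ∈ F, y j = a j) → A.numQueries y ≤ m) →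
      ∑ b : Fin k → ℤˣ, (if ∀ j ∈ F, eraseWord T (E b) j = a j then
        ((b i * A.run (eraseWord T (E b)) : ℤˣ) : ℤ) else 0) = 0 := by
  induction A with
  | output c =>
    intro m F a hF _
    have := sum_coord_mul_pattern hE hT F (by omega) a
    have h2 := congrArg (· * (c : ℤ)) this
    simp only [Finset.sum_mul, ite_mul, zero_mul] at h2
    simpa [QueryAlg.run] using h2
  | query v next ih =>
    intro m F a hF hA
    obtain ⟨m, rfl⟩ : ∃ m', m = m' + 1 :=
      Nat.exists_eq_succ_of_ne_zero (by
        have := hA a (fun _ _ => rfl); simp [QueryAlg.numQueries] at this; omega)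
    have key : ∀ c : ℤˣ, ∑ b : Fin k → ℤˣ,
        (if (∀ j ∈ F, eraseWord T (E b) j = a j) ∧ eraseWord T (E b) v = c then
        ((b i * (next c).run (eraseWord T (E b)) : ℤˣ) : ℤ) else 0) = 0 := by
      intro c
      -- A position may be queried twice; an answer contradicting the earlier one gives an empty
      -- event.
      by_cases hv : v ∈ F ∧ a v ≠ c
      · refine Finset.sum_eq_zero fun b _ => if_neg ?_
        rintro ⟨h1, h2⟩
        exact hv.2 ((h1 v hv.1).symm.trans h2)
      · have hiff : ∀ y : Fin n → ℤˣ, (∀ j ∈ insert v F, y j = Function.update a v c j) ↔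
            (∀ j ∈ F, y j = a j) ∧ y v = c := by
          intro y
          constructor
          · intro h
            have hyv : y v = c := by simpa using h v (mem_insert_self _ _)
            refine ⟨fun j hj => ?_, hyv⟩
            by_cases hjv : j = v
            · subst hjv
              rw [hyv]; by_contra h3; exact hv ⟨hj, fun h4 => h3 h4.symm⟩
            · simpa [hjv] using h j (mem_insert_of_mem hj)
          · rintro ⟨h1, h2⟩ j hj
            by_cases hjv : j = v
            · subst hjv; simpa using h2
            · simpa [hjv] using h1 j (Finset.mem_of_mem_insert_of_ne hj hjv)
        have := ih c m (insert v F) (Function.update a v c)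
          (by have := Finset.card_insert_le v F; omega) (by
            intro y hy
            obtain ⟨h1, h2⟩ := (hiff y).1 hy
            have := hA y h1
            simp only [QueryAlg.numQueries, h2] at this
            omega)
        simpa only [hiff] using this
    have hsplit : ∀ b : Fin k → ℤˣ, (if ∀ j ∈ F, eraseWord T (E b) j = a j then
        ((b i * (QueryAlg.query v next).run (eraseWord T (E b)) : ℤˣ) : ℤ) else 0) =
        ∑ c : ℤˣ, (if (∀ j ∈ F, eraseWord T (E b) j = a j) ∧ eraseWord T (E b) v = c then
        ((b i * (next c).run (eraseWord T (E b)) : ℤˣ) : ℤ) else 0) := by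
      intro b
      by_cases h : ∀ j ∈ F, eraseWord T (E b) j = a j
      · rw [if_pos h, Finset.sum_congr rfl fun c _ => if_congr (and_iff_right h) rfl rfl,
          Finset.sum_ite_eq, if_pos (Finset.mem_univ _), QueryAlg.run]
      · simp [h]
    rw [Finset.sum_congr rfl fun b _ => hsplit b, Finset.sum_comm]
    exact Finset.sum_eq_zero fun c _ => key c

theorem two_mul_card_run_eq_coord {k n : ℕ} {E : (Fin k → ℤˣ) → (Fin n → ℤˣ)}
    (hE : IsLinearCode E) {i : Fin k} {q : ℕ} {T : Finset (Fin n)}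
    (hT : ∀ R, #R ≤ q → IsRecoverySet E i R → ¬ Disjoint R T) (A : QueryAlg n)
    (hA : ∀ y, A.numQueries y ≤ q) :
    2 * #{b : Fin k → ℤˣ | b i = A.run (eraseWord T (E b))} = 2 ^ k := by
  have h := sum_coord_mul_run hE hT A q ∅ 1 (by simp) (fun y _ => hA y)
  have h1 : ∀ b : Fin k → ℤˣ, ((b i * A.run (eraseWord T (E b)) : ℤˣ) : ℤ) =
      2 * (if b i = A.run (eraseWord T (E b)) then 1 else 0) - 1 := by
    intro b
    rcases Int.units_eq_one_or (b i) with h1 | h1 <;>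
      rcases Int.units_eq_one_or (A.run (eraseWord T (E b))) with h2 | h2 <;> simp [h1, h2]
  simp only [notMem_empty, false_imp_iff, implies_true, if_true] at h
  rw [Finset.sum_congr rfl fun b _ => h1 b, Finset.sum_sub_distrib, ← Finset.mul_sum,
    Finset.sum_boole] at h
  simp at h
  zify
  linarith

/-- Take a maximal matching, covering `T`. By maximality every small recovery set meets `T`, so on
words erased along `T` each deterministic algorithm is right for exactly half of the messages. If
|T| ≤ δn, averaging over the messages contradicts the advantage ε. -/
theorem exists_matching_of_isLDC {k n q : ℕ} {δ ε : ℝ} {E : (Fin k → ℤˣ) → (Fin n → ℤˣ)}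
    (hε : 0 < ε) (hE : IsLinearCode E) (hL : IsLDC q δ ε E) (i : Fin k) :
    ∃ M : Finset (Finset (Fin n)), (∀ R ∈ M, #R ≤ q ∧ IsRecoverySet E i R) ∧
      (M : Set (Finset (Fin n))).PairwiseDisjoint id ∧ δ * n ≤ q * (#M : ℝ) := by
  classical
  obtain ⟨Dec, hq, hdec⟩ := hL
  let P : Finset (Finset (Finset (Fin n))) :=
    {M | (∀ R ∈ M, #R ≤ q ∧ IsRecoverySet E i R) ∧
      (M : Set (Finset (Fin n))).PairwiseDisjoint id}
  obtain ⟨M, hMP, hmax⟩ := P.exists_max_image card ⟨∅, by simp [P]⟩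
  have hM := (Finset.mem_filter.1 hMP).2
  refine ⟨M, hM.1, hM.2, ?_⟩
  set T := M.biUnion id with hTdef
  have hcardT : (#T : ℝ) ≤ q * #M := by
    have : #T ≤ #M * q := Finset.card_biUnion_le_card_mul _ _ _ fun R hR => (hM.1 R hR).1
    rw [mul_comm]; exact_mod_cast this
  refine le_trans (le_of_lt ?_) hcardT
  by_contra! hle
  -- Nonemptiness ensures that a recovery set disjoint from `T` is not already in `M`.
  have hne : ∀ R, IsRecoverySet E i R → R.Nonempty := by
    intro R hR
    by_contra h
    rw [Finset.not_nonempty_iff_eq_empty] at h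
    subst h
    have := hR (fun _ => -1)
    simp at this
  have hT : ∀ R, #R ≤ q → IsRecoverySet E i R → ¬ Disjoint R T := by
    intro R hRq hR hd
    have hRM : R ∉ M := by
      intro hmem
      obtain ⟨v, hv⟩ := hne R hR
      exact Finset.disjoint_left.1 hd hv (Finset.mem_biUnion.2 ⟨R, hmem, hv⟩)
    have : insert R M ∈ P := by
      refine Finset.mem_filter.2 ⟨mem_univ _, ?_, ?_⟩
      · intro R' hR'
        rcases Finset.mem_insert.1 hR' with rfl | h
        exacts [⟨hRq, hR⟩, hM.1 _ h]
      · rw [Finset.coe_insert, Set.pairwiseDisjoint_insert]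
        exact ⟨hM.2, fun R' hR' _ => hd.mono_right (Finset.subset_biUnion_of_mem id hR')⟩
    have := hmax _ this
    rw [Finset.card_insert_of_notMem hRM] at this
    omega
  have hdist : ∀ b, (hammingDist (eraseWord T (E b)) (E b) : ℝ) ≤ δ * n := by
    intro b
    refine le_trans ?_ hle
    have : hammingDist (eraseWord T (E b)) (E b) ≤ #T := by
      refine Finset.card_le_card fun j hj => ?_
      by_contra hjT
      simp [eraseWord, hjT] at hj
    exact_mod_cast this
  have hsum : ∑ b : Fin k → ℤˣ, 2 * ((Dec i).map fun A => A.run (eraseWord T (E b))) (b i) =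
      2 ^ k := by
    simp_rw [PMF.map_apply]
    rw [← Finset.mul_sum, ← Summable.tsum_finsetSum (fun _ _ => ENNReal.summable),
      ← ENNReal.tsum_mul_left]
    have : ∀ A, 2 * ∑ b : Fin k → ℤˣ,
        (if b i = A.run (eraseWord T (E b)) then (Dec i) A else 0) = (Dec i) A * 2 ^ k := by
      intro A
      by_cases hA : A ∈ (Dec i).support
      · rw [← Finset.sum_filter, Finset.sum_const, nsmul_eq_mul]
        have h := two_mul_card_run_eq_coord hE hT A (hq i A hA)
        have h' : (2 : ENNReal) * #{b : Fin k → ℤˣ | b i = A.run (eraseWord T (E b))} = 2 ^ k := by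
          exact_mod_cast h
        rw [← mul_assoc, h', mul_comm]
      · rw [PMF.mem_support_iff, not_not] at hA
        simp [hA]
    have hcongr : ∀ A, 2 * ∑ b : Fin k → ℤˣ,
        (@ite _ (b i = A.run (eraseWord T (E b))) (Classical.propDecidable _) ((Dec i) A) 0) =
        (Dec i) A * 2 ^ k := by
      intro A
      rw [← this A]
      congr! 3
    rw [tsum_congr hcongr, ENNReal.tsum_mul_right, (Dec i).tsum_coe, one_mul]
  have hreal := congrArg ENNReal.toReal hsum
  rw [ENNReal.toReal_sum (fun b _ => ENNReal.mul_ne_top (by simp) (PMF.apply_ne_top _ _))] at hreal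
  simp only [ENNReal.toReal_mul, ENNReal.toReal_pow, ENNReal.toReal_ofNat] at hreal
  have hge : ∑ b : Fin k → ℤˣ, (1 + 2 * ε) ≤ (2 : ℝ) ^ k := by
    rw [← hreal]
    exact Finset.sum_le_sum fun b _ => by linarith [hdec i b _ (hdist b)]
  simp at hge
  have : (0 : ℝ) < 2 ^ k := by positivity
  nlinarith

/-! ### Edge isoperimetry in the cube -/

/-- If a ≤ b then a + b ≥ 2a, so log(a + b) exceeds log a by at least log 2. This pays for the edges
crossing between the two halves of a cube. -/
theorem min_mul_log_two_add_le (a b : ℕ) :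
    (min a b : ℝ) * Real.log 2 + a * Real.log a + b * Real.log b ≤
      ((a + b : ℕ) : ℝ) * Real.log ((a + b : ℕ) : ℝ) := by
  wlog h : a ≤ b generalizing a b
  · have := this b a (by omega)
    rw [min_comm, add_comm b a] at this
    linarith
  have hab : (a : ℝ) ≤ b := by exact_mod_cast h
  rw [min_eq_left hab]
  rcases Nat.eq_zero_or_pos a with rfl | ha
  · simp
  have ha' : (0 : ℝ) < a := by exact_mod_cast ha
  have h1 : Real.log 2 + Real.log a ≤ Real.log ((a + b : ℕ) : ℝ) := by
    rw [← Real.log_mul (by norm_num) ha'.ne']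
    exact Real.log_le_log (by positivity) (by push_cast; linarith)
  have h2 : Real.log b ≤ Real.log ((a + b : ℕ) : ℝ) :=
    Real.log_le_log (by linarith) (by push_cast; linarith)
  push_cast at *
  nlinarith

/-- Edge-isoperimetric inequality for multisets in the cube: if every edge is coloured by the first
coordinate in which its ends differ, and each colour class has in- and out-degrees at most `D`,
then there are at most `2 D N log₂ N` edges on `N` vertices. -/
theorem card_mul_log_two_le {U ι : Type*} [DecidableEq U] (x : U → ℕ → ℤˣ)
    (src tgt : ι → U) (c : ι → ℕ) (K : ℕ) (D : ℝ) (s : ℕ) :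
    ∀ (W : Finset U) (𝓔 : Finset ι), (∀ e ∈ 𝓔, src e ∈ W ∧ tgt e ∈ W) →
      (∀ e ∈ 𝓔, c e < K ∧ K ≤ c e + s) →
      (∀ e ∈ 𝓔, ∀ j < c e, x (src e) j = x (tgt e) j) →
      (∀ e ∈ 𝓔, x (src e) (c e) ≠ x (tgt e) (c e)) →
      (∀ j, ∀ u ∈ W, (#{e ∈ 𝓔 | c e = j ∧ src e = u} : ℝ) ≤ D) →
      (∀ j, ∀ u ∈ W, (#{e ∈ 𝓔 | c e = j ∧ tgt e = u} : ℝ) ≤ D) →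
      (#𝓔 : ℝ) * Real.log 2 ≤ 2 * D * (#W * Real.log #W) := by
  classical
  induction s with
  | zero =>
    intro W 𝓔 _ hc _ _ hs _
    have : 𝓔 = ∅ := Finset.eq_empty_of_forall_notMem fun e he => by have := hc e he; omega
    subst this
    rcases W.eq_empty_or_nonempty with rfl | ⟨u, hu⟩
    · simp
    have hD : 0 ≤ D := by simpa using hs 0 u hu
    have : 0 ≤ Real.log (#W : ℝ) := Real.log_natCast_nonneg _
    simp only [card_empty, Nat.cast_zero, zero_mul]
    positivity
  | succ s ih =>
    intro W 𝓔 hW hc heq hne hs ht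
    rcases W.eq_empty_or_nonempty with rfl | ⟨u₀, hu₀⟩
    · have : 𝓔 = ∅ := Finset.eq_empty_of_forall_notMem fun e he => by simpa using (hW e he).1
      simp [this]
    have hD : 0 ≤ D := (Nat.cast_nonneg _).trans (hs 0 u₀ hu₀)
    -- The first coordinate still in play: edges of colour `j₀` cross between the halves `Wz 1` and
    -- `Wz (-1)`, all others stay inside one half.
    set j₀ := K - (s + 1) with hj₀
    have hle : ∀ e ∈ 𝓔, j₀ ≤ c e := fun e he => by have := hc e he; omega
    let Wz : ℤˣ → Finset U := fun z => {u ∈ W | x u j₀ = z}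
    let Ez : ℤˣ → Finset ι := fun z => {e ∈ 𝓔 | j₀ < c e ∧ x (src e) j₀ = z}
    let E₀ : Finset ι := {e ∈ 𝓔 | c e = j₀}
    have hWcard : #W = #(Wz 1) + #(Wz (-1)) := by
      rw [← Finset.card_filter_add_card_filter_not (s := W) (fun u => x u j₀ = 1)]
      congr 2
      ext u
      have := Int.units_ne_iff_eq_neg (u := x u j₀) (v := 1)
      simp [Wz, this]
    have hEcard : #𝓔 = #E₀ + #(Ez 1) + #(Ez (-1)) := by
      rw [← Finset.card_filter_add_card_filter_not (s := 𝓔) (fun e => c e = j₀), add_assoc]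
      congr 1
      rw [← Finset.card_filter_add_card_filter_not
        (s := {e ∈ 𝓔 | ¬ c e = j₀}) (fun e => x (src e) j₀ = 1), filter_filter, filter_filter]
      congr 2
      · refine Finset.filter_congr fun e he => ?_
        have := hle e he
        rw [lt_iff_le_and_ne]
        tauto
      · refine Finset.filter_congr fun e he => ?_
        have := hle e he
        have h2 := Int.units_ne_iff_eq_neg (u := x (src e) j₀) (v := 1)
        rw [lt_iff_le_and_ne, ← h2]
        tauto
    have hIH : ∀ z, (#(Ez z) : ℝ) * Real.log 2 ≤ 2 * D * (#(Wz z) * Real.log #(Wz z)) := by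
      intro z
      refine ih (Wz z) (Ez z) ?_ ?_ ?_ ?_ ?_ ?_
      · intro e he
        obtain ⟨he, hj, hz⟩ := Finset.mem_filter.1 he
        refine ⟨Finset.mem_filter.2 ⟨(hW e he).1, hz⟩, Finset.mem_filter.2 ⟨(hW e he).2, ?_⟩⟩
        rw [← heq e he j₀ hj, hz]
      · intro e he
        obtain ⟨he, hj, hz⟩ := Finset.mem_filter.1 he
        have := hc e he
        omega
      · exact fun e he => heq e (Finset.mem_filter.1 he).1
      · exact fun e he => hne e (Finset.mem_filter.1 he).1
      · intro j u hu
        refine le_trans ?_ (hs j u (Finset.mem_filter.1 hu).1)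
        exact_mod_cast card_le_card (Finset.filter_subset_filter _ (Finset.filter_subset _ _))
      · intro j u hu
        refine le_trans ?_ (ht j u (Finset.mem_filter.1 hu).1)
        exact_mod_cast card_le_card (Finset.filter_subset_filter _ (Finset.filter_subset _ _))
    -- A crossing edge has an end in each half, so it can be charged to the smaller one; the factor
    -- 2 accounts for both orientations.
    have hE₀ : ∀ z, (#E₀ : ℝ) ≤ 2 * D * #(Wz z) := by
      intro z
      have hsub : E₀ ⊆ (Wz z).biUnion fun u =>
          ({e ∈ 𝓔 | c e = j₀ ∧ src e = u} ∪ {e ∈ 𝓔 | c e = j₀ ∧ tgt e = u}) := by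
        intro e he
        obtain ⟨he, hj⟩ := Finset.mem_filter.1 he
        have hne' := hne e he
        rw [hj] at hne'
        rw [Finset.mem_biUnion]
        by_cases hz : x (src e) j₀ = z
        · exact ⟨src e, Finset.mem_filter.2 ⟨(hW e he).1, hz⟩, by simp [he, hj]⟩
        · refine ⟨tgt e, Finset.mem_filter.2 ⟨(hW e he).2, ?_⟩, by simp [he, hj]⟩
          rw [← ne_eq, Int.units_ne_iff_eq_neg] at hz
          rw [Ne.symm (Ne.symm hne') |> Int.units_ne_iff_eq_neg.1] at hz
          exact neg_injective hz
      calc (#E₀ : ℝ) ≤ ∑ u ∈ Wz z, (#({e ∈ 𝓔 | c e = j₀ ∧ src e = u} ∪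
              {e ∈ 𝓔 | c e = j₀ ∧ tgt e = u}) : ℝ) := by
            exact_mod_cast (card_le_card hsub).trans card_biUnion_le
        _ ≤ ∑ u ∈ Wz z, (2 * D) := by
            refine Finset.sum_le_sum fun u hu => ?_
            have hu' := (Finset.mem_filter.1 hu).1
            have h1 : (#({e ∈ 𝓔 | c e = j₀ ∧ src e = u} ∪ {e ∈ 𝓔 | c e = j₀ ∧ tgt e = u}) : ℝ) ≤
                #{e ∈ 𝓔 | c e = j₀ ∧ src e = u} + #{e ∈ 𝓔 | c e = j₀ ∧ tgt e = u} := by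
              exact_mod_cast card_union_le _ _
            linarith [hs j₀ u hu', ht j₀ u hu']
        _ = 2 * D * #(Wz z) := by simp; ring
    have hmin : (#E₀ : ℝ) ≤ 2 * D * (min #(Wz 1) #(Wz (-1)) : ℝ) := by
      rcases min_choice (#(Wz 1) : ℝ) (#(Wz (-1)) : ℝ) with h | h <;> rw [h]
      exacts [hE₀ _, hE₀ _]
    have hlog : 0 ≤ Real.log 2 := Real.log_nonneg (by norm_num)
    have hfin := mul_le_mul_of_nonneg_left
      (min_mul_log_two_add_le #(Wz 1) #(Wz (-1))) (by positivity : 0 ≤ 2 * D)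
    rw [← hWcard] at hfin
    rw [hEcard]
    push_cast
    have := hIH 1
    have := hIH (-1)
    have := mul_le_mul_of_nonneg_right hmin hlog
    nlinarith

/-! ### Counting tuples with prescribed entries -/

section Counting

variable {V : Type*} [Fintype V] [DecidableEq V]

theorem card_filter_forall_eq_mul_pow {α : Type*} [Fintype α] [DecidableEq α] (s : Finset α)
    (g : α → V) :
    #{f : α → V | ∀ x ∈ s, f x = g x} * Fintype.card V ^ #s =
      Fintype.card V ^ Fintype.card α := by
  have h : ({f : α → V | ∀ x ∈ s, f x = g x} : Finset (α → V)) =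
      Fintype.piFinset fun x => if x ∈ s then {g x} else univ := by
    ext f
    simp only [mem_filter, mem_univ, true_and, Fintype.mem_piFinset]
    refine forall_congr' fun x => ?_
    by_cases hx : x ∈ s <;> simp [hx]
  have h2 : Fintype.card V ^ #s = ∏ x : α, if x ∈ s then Fintype.card V else 1 := by
    rw [Finset.prod_ite_mem, univ_inter, Finset.prod_const]
  rw [h, Fintype.card_piFinset, h2, ← Finset.prod_mul_distrib, ← Finset.card_univ (α := α),
    ← Finset.prod_const]
  refine Finset.prod_congr rfl fun x _ => ?_
  by_cases hx : x ∈ s <;> simp [hx]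

theorem card_filter_apply_eq (ℓ : ℕ) (a : Fin ℓ) (b : V) :
    (#{f : Fin ℓ → V | f a = b} : ℝ) = (Fintype.card V : ℝ) ^ ℓ / Fintype.card V := by
  have hV : (Fintype.card V : ℝ) ≠ 0 := by
    exact_mod_cast (Fintype.card_pos_iff.2 ⟨b⟩).ne'
  have h := card_filter_forall_eq_mul_pow {a} (fun _ : Fin ℓ => b)
  simp only [mem_singleton, forall_eq, card_singleton, pow_one, Fintype.card_fin] at h
  rw [eq_div_iff hV]
  exact_mod_cast h

/-- The term a' = a contributes the indicator of b = b'; every other position is independent of a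
and contributes a factor 1/|V|. -/
theorem sum_card_filter_apply_eq_le (ℓ : ℕ) (a : Fin ℓ) (b b' : V) :
    ∑ a' : Fin ℓ, (#{f : Fin ℓ → V | f a = b ∧ f a' = b'} : ℝ) ≤
      (Fintype.card V : ℝ) ^ ℓ / Fintype.card V *
        ((if b = b' then 1 else 0) + ℓ / Fintype.card V) := by
  have hV : (0 : ℝ) < (Fintype.card V : ℝ) := by
    exact_mod_cast (Fintype.card_pos_iff.2 ⟨b⟩)
  have h1 : (#{f : Fin ℓ → V | f a = b ∧ f a = b'} : ℝ) =
      (Fintype.card V : ℝ) ^ ℓ / Fintype.card V * (if b = b' then 1 else 0) := by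
    split_ifs with h
    · subst h
      simp only [and_self, mul_one]
      exact card_filter_apply_eq ℓ a b
    · rw [mul_zero, Nat.cast_eq_zero, card_eq_zero]
      exact Finset.filter_eq_empty_iff.2 fun f _ hf => h (hf.1.symm.trans hf.2)
  have h2 : ∀ a' ∈ univ.erase a, (#{f : Fin ℓ → V | f a = b ∧ f a' = b'} : ℝ) =
      (Fintype.card V : ℝ) ^ ℓ / Fintype.card V * (1 / Fintype.card V) := by
    intro a' ha'
    have hne : a' ≠ a := (Finset.mem_erase.1 ha').1
    have h := card_filter_forall_eq_mul_pow {a, a'} (fun x : Fin ℓ => if x = a then b else b')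
    rw [card_pair hne.symm] at h
    simp only [mem_insert, mem_singleton, forall_eq_or_imp, forall_eq, if_true, if_neg hne,
      Fintype.card_fin] at h
    have h' : (#{f : Fin ℓ → V | f a = b ∧ f a' = b'} : ℝ) * (Fintype.card V : ℝ) ^ 2 =
      (Fintype.card V : ℝ) ^ ℓ := by exact_mod_cast h
    rw [← h']
    field_simp
  rw [← Finset.add_sum_erase _ _ (mem_univ a), h1, Finset.sum_congr rfl h2, Finset.sum_const,
    nsmul_eq_mul, mul_add]
  have h3 : (#(univ.erase a) : ℝ) ≤ ℓ := by
    exact_mod_cast (card_le_univ _).trans (Fintype.card_fin ℓ).le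
  rw [mul_left_comm, mul_one_div]
  gcongr

theorem card_filter_forall_apply_eq {m ℓ : ℕ} (a : Fin m → Fin ℓ) (B : Fin m → V) :
    (#{S : Fin m → Fin ℓ → V | ∀ r, S r (a r) = B r} : ℝ) =
      ((Fintype.card V : ℝ) ^ ℓ / Fintype.card V) ^ m := by
  have h : ({S : Fin m → Fin ℓ → V | ∀ r, S r (a r) = B r} : Finset _) =
      Fintype.piFinset fun r => {f : Fin ℓ → V | f (a r) = B r} := by
    ext S; simp [Fintype.mem_piFinset]
  rw [h, Fintype.card_piFinset, Nat.cast_prod,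
    Finset.prod_congr rfl fun r _ => card_filter_apply_eq ℓ (a r) (B r)]
  simp only [prod_const, card_univ, Fintype.card_fin]

theorem sum_card_filter_forall_apply_eq_le {m ℓ : ℕ} (a : Fin m → Fin ℓ) (B B' : Fin m → V) :
    ∑ a' : Fin m → Fin ℓ,
      (#{S : Fin m → Fin ℓ → V | (∀ r, S r (a r) = B r) ∧ ∀ r, S r (a' r) = B' r} : ℝ) ≤
      ((Fintype.card V : ℝ) ^ ℓ / Fintype.card V) ^ m *
        ∏ r, ((if B r = B' r then 1 else 0) + (ℓ : ℝ) / Fintype.card V) := by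
  have h : ∀ a' : Fin m → Fin ℓ,
      (#{S : Fin m → Fin ℓ → V | (∀ r, S r (a r) = B r) ∧ ∀ r, S r (a' r) = B' r} : ℝ) =
      ∏ r, (#{f : Fin ℓ → V | f (a r) = B r ∧ f (a' r) = B' r} : ℝ) := by
    intro a'
    rw [← Nat.cast_prod, ← Fintype.card_piFinset]
    congr 2
    ext S
    simp [Fintype.mem_piFinset, forall_and]
  rw [Finset.sum_congr rfl fun a' _ => h a', ← Fintype.piFinset_univ,
    ← Finset.prod_univ_sum (fun _ => (univ : Finset (Fin ℓ)))
      (fun r x => (#{f : Fin ℓ → V | f (a r) = B r ∧ f x = B' r} : ℝ))]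
  calc _ ≤ ∏ r : Fin m, ((Fintype.card V : ℝ) ^ ℓ / Fintype.card V *
        ((if B r = B' r then 1 else 0) + (ℓ : ℝ) / Fintype.card V)) :=
        Finset.prod_le_prod (fun r _ => Finset.sum_nonneg fun _ _ => by positivity)
          fun r _ => sum_card_filter_apply_eq_le ℓ (a r) (B r) (B' r)
    _ = _ := by rw [Finset.prod_mul_distrib, prod_const, card_univ, Fintype.card_fin]

end Counting

/-! ### The Kikuchi graph -/

section Kikuchi

variable {V ι : Type*} {m ℓ : ℕ}

/-- The tuple whose entries at positions in `I` come from the first hyperedge of the pair `z`, and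
whose other entries come from the second one. -/
def mixed (f : ι → Fin m → V) (I : Finset (Fin m)) (z : ι × ι) (r : Fin m) : V :=
  if r ∈ I then f z.1 r else f z.2 r

variable [DecidableEq V] (c : ι → ℕ) (f : ι → Fin m → V)
  (𝓟 : Finset (ι × ι))

/-- The moves of colour `j` available at the vertex `S` of the Kikuchi graph. -/
def kikuchiMoves (I : Finset (Fin m)) (j : ℕ) (S : Fin m → Fin ℓ → V) :
    Finset ((ι × ι) × (Fin m → Fin ℓ)) :=
  {w ∈ 𝓟 ×ˢ univ | c w.1.1 = j ∧ ∀ r, S r (w.2 r) = mixed f I w.1 r}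

theorem card_kikuchiMoves (I : Finset (Fin m)) (j : ℕ) (S : Fin m → Fin ℓ → V) :
    (#(kikuchiMoves c f 𝓟 I j S) : ℝ) = ∑ w ∈ 𝓟 with c w.1 = j, ∑ a' : Fin m → Fin ℓ,
      if ∀ r, S r (a' r) = mixed f I w r then (1 : ℝ) else 0 := by
  rw [kikuchiMoves, ← Finset.sum_boole, Finset.sum_product, Finset.sum_filter]
  refine Finset.sum_congr rfl fun w _ => ?_
  split_ifs with h <;> simp [h]

/-- Expanding the product over the set `R` of blocks where agreement is imposed gives 2^m terms,
each at most K p^|R| p^(m-|R|). -/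
theorem sum_prod_indicator_add_le {p K : ℝ} (hp : 0 ≤ p) {z : ι × ι} (I : Finset (Fin m))
    (hK : ∀ R : Finset (Fin m), (#{w ∈ 𝓟 | c w.1 = c z.1 ∧
      ∀ r ∈ R, mixed f I z r = mixed f I w r} : ℝ) ≤ K * p ^ #R) :
    ∑ w ∈ 𝓟 with c w.1 = c z.1, ∏ r : Fin m, ((if mixed f I z r = mixed f I w r then 1 else 0) + p)
      ≤ 2 ^ m * K * p ^ m := by
  simp_rw [Finset.prod_add]
  rw [Finset.sum_comm]
  have h : ∀ R ∈ (univ : Finset (Fin m)).powerset, ∑ w ∈ 𝓟 with c w.1 = c z.1,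
      ((∏ r ∈ R, if mixed f I z r = mixed f I w r then (1 : ℝ) else 0) *
        ∏ _r ∈ univ \ R, p) ≤ K * p ^ m := by
    intro R _
    rw [← Finset.sum_mul]
    have h1 : ∑ w ∈ 𝓟 with c w.1 = c z.1,
        (∏ r ∈ R, if mixed f I z r = mixed f I w r then (1 : ℝ) else 0) =
        #{w ∈ 𝓟 | c w.1 = c z.1 ∧ ∀ r ∈ R, mixed f I z r = mixed f I w r} := by
      rw [← Finset.filter_filter, ← Finset.sum_boole]
      refine Finset.sum_congr rfl fun w _ => ?_
      rw [Finset.prod_boole]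
      congr
    rw [h1, Finset.prod_const]
    have h2 : #R + #(univ \ R) = m := by
      have := Finset.card_sdiff_add_card_eq_card (Finset.subset_univ R)
      rw [Finset.card_univ, Fintype.card_fin] at this
      omega
    calc _ ≤ K * p ^ #R * p ^ #(univ \ R) := mul_le_mul_of_nonneg_right (hK R) (by positivity)
      _ = K * p ^ m := by rw [mul_assoc, ← pow_add, h2]
  refine (Finset.sum_le_sum h).trans ?_
  simp
  linarith

variable [Fintype V]

/-- The directed edges of the Kikuchi graph, as pairs of a move and the vertex it starts from. -/
def kikuchiEdges (ℓ : ℕ) (I : Finset (Fin m)) :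
    Finset (((ι × ι) × (Fin m → Fin ℓ)) × (Fin m → Fin ℓ → V)) :=
  {e ∈ (𝓟 ×ˢ univ) ×ˢ univ | ∀ r, e.2 r (e.1.2 r) = mixed f I e.1.1 r}

/-- The reversal of a directed edge of the Kikuchi graph. -/
def kikuchiFlip (I : Finset (Fin m)) (e : ((ι × ι) × (Fin m → Fin ℓ)) × (Fin m → Fin ℓ → V)) :
    ((ι × ι) × (Fin m → Fin ℓ)) × (Fin m → Fin ℓ → V) :=
  (e.1, fun r => Function.update (e.2 r) (e.1.2 r) (mixed f Iᶜ e.1.1 r))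

theorem sum_kikuchiEdges (I : Finset (Fin m))
    (φ : ((ι × ι) × (Fin m → Fin ℓ)) × (Fin m → Fin ℓ → V) → ℝ) :
    ∑ e ∈ kikuchiEdges f 𝓟 ℓ I, φ e = ∑ z ∈ 𝓟, ∑ a : Fin m → Fin ℓ,
      ∑ S : Fin m → Fin ℓ → V with ∀ r, S r (a r) = mixed f I z r, φ ((z, a), S) := by
  rw [kikuchiEdges, Finset.sum_filter, Finset.sum_product, Finset.sum_product]
  simp_rw [Finset.sum_filter]

theorem card_kikuchiEdges (I : Finset (Fin m)) :
    (#(kikuchiEdges f 𝓟 ℓ I) : ℝ) =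
      #𝓟 * ((ℓ : ℝ) ^ m * ((Fintype.card V : ℝ) ^ ℓ / Fintype.card V) ^ m) := by
  have h := sum_kikuchiEdges (ℓ := ℓ) f 𝓟 I fun _ => (1 : ℝ)
  simp only [Finset.sum_const, nsmul_eq_mul, mul_one] at h
  rw [h]
  simp [card_filter_forall_apply_eq]

/-- First moment of the colour degree at the source of a uniformly random edge: conditioned on one
move being available, blocks are independent, so another pair `w` contributes a product of agreement
indicators plus p. -/
theorem sum_card_kikuchiMoves_le {p K : ℝ} (hpdef : p = (ℓ : ℝ) / Fintype.card V)
    (I : Finset (Fin m))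
    (hK : ∀ z ∈ 𝓟, ∀ R : Finset (Fin m), (#{w ∈ 𝓟 | c w.1 = c z.1 ∧
      ∀ r ∈ R, mixed f I z r = mixed f I w r} : ℝ) ≤ K * p ^ #R) :
    ∑ e ∈ kikuchiEdges f 𝓟 ℓ I, (#(kikuchiMoves c f 𝓟 I (c e.1.1.1) e.2) : ℝ) ≤
      #(kikuchiEdges f 𝓟 ℓ I) * (2 ^ m * K * p ^ m) := by
  have hp : 0 ≤ p := by rw [hpdef]; positivity
  rw [sum_kikuchiEdges, card_kikuchiEdges]
  have key : ∀ z ∈ 𝓟, ∀ a : Fin m → Fin ℓ,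
      ∑ S : Fin m → Fin ℓ → V with ∀ r, S r (a r) = mixed f I z r,
        (#(kikuchiMoves c f 𝓟 I (c z.1) S) : ℝ) ≤
      ((Fintype.card V : ℝ) ^ ℓ / Fintype.card V) ^ m * (2 ^ m * K * p ^ m) := by
    intro z hz a
    simp_rw [card_kikuchiMoves]
    rw [Finset.sum_comm]
    refine le_trans ?_ (mul_le_mul_of_nonneg_left
      (sum_prod_indicator_add_le c f 𝓟 hp I (hK z hz)) (by positivity))
    rw [Finset.mul_sum]
    refine Finset.sum_le_sum fun w _ => ?_
    rw [Finset.sum_comm, hpdef]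
    refine le_trans (le_of_eq ?_)
      (sum_card_filter_forall_apply_eq_le a (mixed f I z) (mixed f I w))
    refine Finset.sum_congr rfl fun a' _ => ?_
    rw [Finset.sum_boole, Finset.filter_filter]
  calc _ ≤ ∑ z ∈ 𝓟, ∑ a : Fin m → Fin ℓ,
        ((Fintype.card V : ℝ) ^ ℓ / Fintype.card V) ^ m * (2 ^ m * K * p ^ m) :=
        Finset.sum_le_sum fun z hz => Finset.sum_le_sum fun a _ => key z hz a
    _ = _ := by simp; ring

/-- Markov's inequality at four times the mean bound. -/
theorem four_mul_card_overloaded_le {p K : ℝ} (hp0 : 0 < p) (hK0 : 0 < K)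
    (hpdef : p = (ℓ : ℝ) / Fintype.card V) (I : Finset (Fin m))
    (hK : ∀ z ∈ 𝓟, ∀ R : Finset (Fin m), (#{w ∈ 𝓟 | c w.1 = c z.1 ∧
      ∀ r ∈ R, mixed f I z r = mixed f I w r} : ℝ) ≤ K * p ^ #R) :
    4 * (#{e ∈ kikuchiEdges f 𝓟 ℓ I | 4 * (2 ^ m * K * p ^ m) <
      (#(kikuchiMoves c f 𝓟 I (c e.1.1.1) e.2) : ℝ)} : ℝ) ≤ #(kikuchiEdges f 𝓟 ℓ I) := by
  have hc : 0 < 2 ^ m * K * p ^ m := by positivity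
  have h := sum_card_kikuchiMoves_le c f 𝓟 hpdef I hK
  have h1 : (#{e ∈ kikuchiEdges f 𝓟 ℓ I | 4 * (2 ^ m * K * p ^ m) <
      (#(kikuchiMoves c f 𝓟 I (c e.1.1.1) e.2) : ℝ)} : ℝ) * (4 * (2 ^ m * K * p ^ m)) ≤
      ∑ e ∈ kikuchiEdges f 𝓟 ℓ I, (#(kikuchiMoves c f 𝓟 I (c e.1.1.1) e.2) : ℝ) := by
    rw [← nsmul_eq_mul]
    refine (Finset.card_nsmul_le_sum _ _ _ fun e he => (Finset.mem_filter.1 he).2.le).trans ?_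
    exact Finset.sum_le_sum_of_subset_of_nonneg (Finset.filter_subset _ _)
      fun _ _ _ => Nat.cast_nonneg _
  refine le_of_mul_le_mul_right ?_ hc
  linarith

theorem kikuchiFlip_mem {I : Finset (Fin m)}
    {e : ((ι × ι) × (Fin m → Fin ℓ)) × (Fin m → Fin ℓ → V)} (he : e ∈ kikuchiEdges f 𝓟 ℓ I) :
    kikuchiFlip f I e ∈ kikuchiEdges f 𝓟 ℓ Iᶜ := by
  simp only [kikuchiEdges, mem_filter, mem_product, mem_univ, and_true, kikuchiFlip] at he ⊢
  exact ⟨he.1, fun r => by simp⟩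

theorem kikuchiFlip_injOn (I : Finset (Fin m)) :
    Set.InjOn (kikuchiFlip f I) (kikuchiEdges f 𝓟 ℓ I : Set
      (((ι × ι) × (Fin m → Fin ℓ)) × (Fin m → Fin ℓ → V))) := by
  rintro ⟨w, S⟩ hS ⟨w', S'⟩ hS' h
  simp only [kikuchiFlip, Prod.mk.injEq] at h
  obtain ⟨rfl, h⟩ := h
  refine Prod.ext rfl (funext fun r => funext fun a => ?_)
  have h1 := (Finset.mem_filter.1 (Finset.mem_coe.1 hS)).2 r
  have h2 := (Finset.mem_filter.1 (Finset.mem_coe.1 hS')).2 r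
  by_cases ha : a = w.2 r
  · subst ha; exact h1.trans h2.symm
  · have := congrFun (congrFun h r) a
    simpa [ha] using this

theorem prod_update_mul {M α V : Type*} [CommMonoid M] [Fintype α] [DecidableEq α] (g : V → M)
    (S : α → V) (a : α) (b : V) :
    (∏ a', g (Function.update S a b a')) * g (S a) = (∏ a', g (S a')) * g b := by
  rw [← Finset.mul_prod_erase _ _ (mem_univ a),
    ← Finset.mul_prod_erase _ (fun a' => g (S a')) (mem_univ a), Function.update_self,
    Finset.prod_congr rfl fun a' ha' => by
      rw [Function.update_of_ne (Finset.mem_erase.1 ha').1]]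
  simp only [mul_comm, mul_left_comm]

/-- Each block trades one entry of the pair for the other; labels being involutions, the total
change is the product over both hyperedges. -/
theorem kikuchi_label {x : V → ℕ → ℤˣ} {I : Finset (Fin m)} {L : ℕ → ℤˣ}
    {e : ((ι × ι) × (Fin m → Fin ℓ)) × (Fin m → Fin ℓ → V)} (he : e ∈ kikuchiEdges f 𝓟 ℓ I)
    (hL : (∏ r, x (f e.1.1.1 r)) * ∏ r, x (f e.1.1.2 r) = L) :
    ∏ r, ∏ a, x ((kikuchiFlip f I e).2 r a) = (∏ r, ∏ a, x (e.2 r a)) * L := by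
  have hsq : ∀ y : ℕ → ℤˣ, y * y = 1 := fun y => funext fun j => by
    rw [Pi.mul_apply, ← sq, Int.units_sq, Pi.one_apply]
  have h1 : ∀ r, (∏ a, x ((kikuchiFlip f I e).2 r a)) * x (mixed f I e.1.1 r) =
      (∏ a, x (e.2 r a)) * x (mixed f Iᶜ e.1.1 r) := by
    intro r
    rw [← (Finset.mem_filter.1 he).2 r]
    exact prod_update_mul x (e.2 r) (e.1.2 r) _
  have h2 := Finset.prod_congr rfl fun r (_ : r ∈ univ) => h1 r
  rw [Finset.prod_mul_distrib, Finset.prod_mul_distrib] at h2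
  have h3 : (∏ r, x (mixed f I e.1.1 r)) * ∏ r, x (mixed f Iᶜ e.1.1 r) = L := by
    rw [← hL, ← Finset.prod_mul_distrib, ← Finset.prod_mul_distrib]
    refine Finset.prod_congr rfl fun r _ => ?_
    by_cases hr : r ∈ I <;> simp [mixed, hr, mul_comm]
  rw [← h3]
  calc _ = (∏ r, ∏ a, x ((kikuchiFlip f I e).2 r a)) * (∏ r, x (mixed f I e.1.1 r)) *
        ∏ r, x (mixed f I e.1.1 r) := by rw [mul_assoc, hsq, mul_one]
    _ = _ := by rw [h2, mul_assoc, mul_comm (∏ r, x (mixed f Iᶜ e.1.1 r))]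

/-- If the pairs of hyperedges in `𝓟` overlap each other little, there are few of them. -/
theorem card_pairs_mul_log_two_le (x : V → ℕ → ℤˣ) {k : ℕ} {p K : ℝ} (hp0 : 0 < p) (hK0 : 0 < K)
    (hpdef : p = (ℓ : ℝ) / Fintype.card V) (I : Finset (Fin m))
    (hc : ∀ z ∈ 𝓟, c z.1 < c z.2 ∧ c z.2 < k)
    (hx : ∀ z ∈ 𝓟, (∏ r, x (f z.1 r)) * ∏ r, x (f z.2 r) =
      Pi.mulSingle (c z.1) (-1) * Pi.mulSingle (c z.2) (-1))
    (hK : ∀ z ∈ 𝓟, ∀ R : Finset (Fin m), (#{w ∈ 𝓟 | c w.1 = c z.1 ∧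
      ∀ r ∈ R, mixed f I z r = mixed f I w r} : ℝ) ≤ K * p ^ #R)
    (hK' : ∀ z ∈ 𝓟, ∀ R : Finset (Fin m), (#{w ∈ 𝓟 | c w.1 = c z.1 ∧
      ∀ r ∈ R, mixed f Iᶜ z r = mixed f Iᶜ w r} : ℝ) ≤ K * p ^ #R) :
    (#𝓟 : ℝ) * Real.log 2 ≤ 16 * 2 ^ m * K * (m * (ℓ * Real.log (Fintype.card V))) := by
  classical
  have hV : 0 < (Fintype.card V : ℝ) := by
    -- For empty `V`, division by zero would give p = 0.
    rcases (Nat.cast_nonneg (α := ℝ) (Fintype.card V)).eq_or_lt with h | h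
    · rw [← h] at hpdef; simp at hpdef; linarith
    · exact h
  set D := 4 * (2 ^ m * K * p ^ m) with hD
  have hD0 : 0 ≤ D := by positivity
  let bad : Finset (Fin m) → Finset (((ι × ι) × (Fin m → Fin ℓ)) × (Fin m → Fin ℓ → V)) :=
    fun J => {e ∈ kikuchiEdges f 𝓟 ℓ J | D < (#(kikuchiMoves c f 𝓟 J (c e.1.1.1) e.2) : ℝ)}
  have hbad := four_mul_card_overloaded_le c f 𝓟 hp0 hK0 hpdef I hK
  have hbad' := four_mul_card_overloaded_le c f 𝓟 hp0 hK0 hpdef Iᶜ hK'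
  change 4 * (#(bad I) : ℝ) ≤ _ at hbad
  change 4 * (#(bad Iᶜ) : ℝ) ≤ _ at hbad'
  -- Edges overloaded at neither end; each end excludes at most a quarter of the edges.
  let good := {e ∈ kikuchiEdges f 𝓟 ℓ I | e ∉ bad I ∧ kikuchiFlip f I e ∉ bad Iᶜ}
  have hgood : (#(kikuchiEdges f 𝓟 ℓ I) : ℝ) ≤ 2 * #good := by
    have hsub : kikuchiEdges f 𝓟 ℓ I ⊆
        good ∪ (bad I ∪ {e ∈ kikuchiEdges f 𝓟 ℓ I | kikuchiFlip f I e ∈ bad Iᶜ}) := by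
      intro e he
      simp only [good, mem_union, mem_filter, he, true_and]
      tauto
    have h1 : #{e ∈ kikuchiEdges f 𝓟 ℓ I | kikuchiFlip f I e ∈ bad Iᶜ} ≤ #(bad Iᶜ) :=
      Finset.card_le_card_of_injOn (kikuchiFlip f I) (fun e he => (Finset.mem_filter.1 he).2)
        ((kikuchiFlip_injOn f 𝓟 I).mono fun e he => (Finset.mem_filter.1 he).1)
    have h2 := (card_le_card hsub).trans ((card_union_le _ _).trans
      (Nat.add_le_add_left ((card_union_le _ _).trans (Nat.add_le_add_left h1 _)) _))
    have h3 : (#(kikuchiEdges f 𝓟 ℓ I) : ℝ) ≤ #good + (#(bad I) + #(bad Iᶜ)) := by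
      exact_mod_cast h2
    rw [card_kikuchiEdges] at hbad' hbad h3 ⊢
    linarith
  have hmoves : ∀ (J : Finset (Fin m)) (j : ℕ) (S : Fin m → Fin ℓ → V)
      (T : Finset (((ι × ι) × (Fin m → Fin ℓ)) × (Fin m → Fin ℓ → V))),
      (∀ e ∈ T, (e.1, S) ∈ kikuchiEdges f 𝓟 ℓ J ∧ (e.1, S) ∉ bad J ∧ c e.1.1.1 = j) →
      Set.InjOn Prod.fst (T : Set (((ι × ι) × (Fin m → Fin ℓ)) × (Fin m → Fin ℓ → V))) →
      (#T : ℝ) ≤ D := by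
    intro J j S T hT hinj
    rcases T.eq_empty_or_nonempty with rfl | ⟨e₀, he₀⟩
    · simpa using hD0
    have h1 : #T ≤ #(kikuchiMoves c f 𝓟 J j S) := by
      refine Finset.card_le_card_of_injOn Prod.fst (fun e he => ?_) hinj
      obtain ⟨h2, -, h3⟩ := hT e he
      have h4 := Finset.mem_filter.1 h2
      exact Finset.mem_filter.2 ⟨(Finset.mem_product.1 h4.1).1, h3, h4.2⟩
    obtain ⟨h2, h3, h4⟩ := hT e₀ he₀
    have h5 : ¬ D < (#(kikuchiMoves c f 𝓟 J (c e₀.1.1.1) S) : ℝ) :=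
      fun h => h3 (Finset.mem_filter.2 ⟨h2, h⟩)
    rw [h4, not_lt] at h5
    exact le_trans (by exact_mod_cast h1) h5
  have hedge : ∀ e ∈ good, e ∈ kikuchiEdges f 𝓟 ℓ I := fun e he => (Finset.mem_filter.1 he).1
  have hmem : ∀ e ∈ good, e.1.1 ∈ 𝓟 := fun e he =>
    (Finset.mem_product.1 (Finset.mem_product.1 (Finset.mem_filter.1 (hedge e he)).1).1).1
  have hlab := fun e (he : e ∈ good) => kikuchi_label f 𝓟 (hedge e he) (hx _ (hmem e he))
  -- The label changes exactly in the two colours of the pair, so the first change is at the smaller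
  -- colour.
  have hcube := card_mul_log_two_le
    (fun S : Fin m → Fin ℓ → V => ∏ r, ∏ a, x (S r a)) (fun e => e.2)
    (fun e => (kikuchiFlip f I e).2) (fun e => c e.1.1.1) k D k univ good
    (fun e _ => ⟨mem_univ _, mem_univ _⟩)
    (fun e he => by have := hc _ (hmem e he); omega)
    (fun e he j hj => by
      have hj' : j ≠ c e.1.1.2 := by have := hc _ (hmem e he); omega
      simp only [hlab e he, Pi.mul_apply, Pi.mulSingle_eq_of_ne hj.ne, Pi.mulSingle_eq_of_ne hj',
        mul_one])
    (fun e he => by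
      have hj' : c e.1.1.1 ≠ c e.1.1.2 := by have := hc _ (hmem e he); omega
      simp only [hlab e he, Pi.mul_apply, Pi.mulSingle_eq_same, Pi.mulSingle_eq_of_ne hj', mul_one]
      intro h
      rw [left_eq_mul] at h
      exact absurd h (by decide))
    (fun j S _ => hmoves I j S _ (fun e he => by
        obtain ⟨h1, h2, h3⟩ := Finset.mem_filter.1 he
        subst h3
        exact ⟨hedge e h1, (Finset.mem_filter.1 h1).2.1, h2⟩)
      (fun e he e' he' h => by
        have h1 := (Finset.mem_filter.1 he).2.2
        have h2 := (Finset.mem_filter.1 he').2.2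
        exact Prod.ext h (h1.trans h2.symm)))
    (fun j S _ => hmoves Iᶜ j S _ (fun e he => by
        obtain ⟨h1, h2, h3⟩ := Finset.mem_filter.1 he
        subst h3
        exact ⟨kikuchiFlip_mem f 𝓟 (hedge e h1), (Finset.mem_filter.1 h1).2.2, h2⟩)
      (fun e he e' he' h => by
        obtain ⟨h1, -, h2⟩ := Finset.mem_filter.1 he
        obtain ⟨h1', -, h2'⟩ := Finset.mem_filter.1 he'
        exact kikuchiFlip_injOn f 𝓟 I (hedge e h1) (hedge e' h1')
          (Prod.ext h (h2.trans h2'.symm))))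
  have hcardU : (#(univ : Finset (Fin m → Fin ℓ → V)) : ℝ) = ((Fintype.card V : ℝ) ^ ℓ) ^ m := by
    simp
  have hlogU : Real.log (((Fintype.card V : ℝ) ^ ℓ) ^ m) =
      m * (ℓ * Real.log (Fintype.card V)) := by
    rw [Real.log_pow, Real.log_pow]
  rw [hcardU, hlogU] at hcube
  have hE : (#(kikuchiEdges f 𝓟 ℓ I) : ℝ) = #𝓟 * (p ^ m * ((Fintype.card V : ℝ) ^ ℓ) ^ m) := by
    rw [card_kikuchiEdges, hpdef, ← mul_pow, ← mul_pow]
    congr 2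
    field_simp
  rw [hE] at hgood
  have hN : 0 < p ^ m * ((Fintype.card V : ℝ) ^ ℓ) ^ m := by positivity
  have hlog : 0 ≤ Real.log 2 := Real.log_nonneg (by norm_num)
  refine le_of_mul_le_mul_right ?_ hN
  have h6 := mul_le_mul_of_nonneg_right hgood hlog
  calc _ = (#𝓟 : ℝ) * (p ^ m * ((Fintype.card V : ℝ) ^ ℓ) ^ m) * Real.log 2 := by ring
    _ ≤ 2 * (2 * D * (((Fintype.card V : ℝ) ^ ℓ) ^ m *
        (m * (ℓ * Real.log (Fintype.card V))))) := by linarith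
    _ = _ := by rw [hD]; ring

end Kikuchi

/-! ### Groups of hyperedges with a common core -/

/-- The generic degree of a set of `s` vertices among `n` vertices at density `p`, but at least
`1`. -/
noncomputable def degreeScale (n : ℕ) (p : ℝ) (s : ℕ) : ℝ := max 1 (n * p ^ s)

theorem one_le_degreeScale (n : ℕ) (p : ℝ) (s : ℕ) : 1 ≤ degreeScale n p s := le_max_left _ _

/-- Square and use n²p^q ≥ 1. This is where the size of ℓ enters. -/
theorem one_le_mul_pow_of_two_mul_le {n q s : ℕ} {p : ℝ} (hp0 : 0 ≤ p) (hp1 : p ≤ 1)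
    (hpq : 1 ≤ (n : ℝ) ^ 2 * p ^ q) (hs : 2 * s ≤ q) : 1 ≤ n * p ^ s := by
  have h1 : 1 ≤ ((n : ℝ) * p ^ s) ^ 2 := by
    rw [mul_pow, ← pow_mul, mul_comm s]
    exact hpq.trans (mul_le_mul_of_nonneg_left (pow_le_pow_of_le_one hp0 hp1 hs) (by positivity))
  by_contra! h
  have h2 : 0 ≤ (n : ℝ) * p ^ s := by positivity
  nlinarith

section Groups

variable {V ι : Type*}

/-- `𝓖` consists of disjoint groups of `g` hyperedges from `𝓕`, where the hyperedges of each group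
have `t` common vertices. -/
structure IsGrouping (e : ι → Finset V) (𝓕 : Finset ι) (t g : ℕ) (𝓖 : Finset (Finset ι)) :
    Prop where
  subset : ∀ G ∈ 𝓖, G ⊆ 𝓕
  card : ∀ G ∈ 𝓖, #G = g
  core : ∀ G ∈ 𝓖, ∃ Q : Finset V, #Q = t ∧ ∀ i ∈ G, Q ⊆ e i
  disjoint : (𝓖 : Set (Finset ι)).PairwiseDisjoint id

variable {e : ι → Finset V} {c : ι → ℕ} {𝓕 : Finset ι} {t g : ℕ} {𝓖 : Finset (Finset ι)}

theorem IsGrouping.eq_of_mem (h : IsGrouping e 𝓕 t g 𝓖) {G G' : Finset ι} (hG : G ∈ 𝓖)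
    (hG' : G' ∈ 𝓖) {i : ι} (hi : i ∈ G) (hi' : i ∈ G') : G = G' := by
  by_contra hne
  exact Finset.disjoint_left.1 (h.disjoint hG hG' hne) hi hi'

theorem IsGrouping.eq_of_color_eq (h : IsGrouping e 𝓕 t g 𝓖) (ht : 1 ≤ t)
    (hdisj : ∀ i i', c i = c i' → i ≠ i' → Disjoint (e i) (e i')) {G : Finset ι} (hG : G ∈ 𝓖)
    {i i' : ι} (hi : i ∈ G) (hi' : i' ∈ G) (hc : c i = c i') : i = i' := by
  by_contra hne
  obtain ⟨Q, hQ, hsub⟩ := h.core G hG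
  obtain ⟨v, hv⟩ : Q.Nonempty := Finset.card_pos.1 (by omega)
  exact Finset.disjoint_left.1 (hdisj i i' hc hne) (hsub i hi hv) (hsub i' hi' hv)

variable [DecidableEq ι]

/-- The pairs of hyperedges in a common group, in the order of their colours. -/
def groupPairs (c : ι → ℕ) (𝓕 : Finset ι) (𝓖 : Finset (Finset ι)) : Finset (ι × ι) :=
  {z ∈ 𝓕 ×ˢ 𝓕 | (∃ G ∈ 𝓖, z.1 ∈ G ∧ z.2 ∈ G) ∧ c z.1 < c z.2}

/-- Members of a group share a vertex, hence have distinct colours, so each unordered pair is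
counted once: g(g-1)/2 ≥ g²/4. -/
theorem IsGrouping.card_mul_sq_le (h : IsGrouping e 𝓕 t g 𝓖) (ht : 1 ≤ t) (hg : 2 ≤ g)
    (hdisj : ∀ i i', c i = c i' → i ≠ i' → Disjoint (e i) (e i')) :
    #𝓖 * (g * g) ≤ 4 * #(groupPairs c 𝓕 𝓖) := by
  let T : Finset ι → Finset (ι × ι) := fun G => {z ∈ G ×ˢ G | c z.1 < c z.2}
  have hT : ∀ G ∈ 𝓖, g * g ≤ #(T G) * 4 := by
    intro G hG
    have hsub : G.offDiag ⊆ T G ∪ (T G).image Prod.swap := by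
      rintro ⟨i, i'⟩ hz
      obtain ⟨hi, hi', hne⟩ := Finset.mem_offDiag.1 hz
      rcases lt_trichotomy (c i) (c i') with hlt | heq | hlt
      · exact Finset.mem_union_left _ (Finset.mem_filter.2 ⟨Finset.mk_mem_product hi hi', hlt⟩)
      · exact absurd (h.eq_of_color_eq ht hdisj hG hi hi' heq) hne
      · exact Finset.mem_union_right _ (Finset.mem_image.2 ⟨(i', i),
          Finset.mem_filter.2 ⟨Finset.mk_mem_product hi' hi, hlt⟩, rfl⟩)
    have h1 := (card_le_card hsub).trans ((card_union_le _ _).trans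
      (Nat.add_le_add_left card_image_le _))
    rw [Finset.offDiag_card, h.card G hG] at h1
    have : 2 * g ≤ g * g := Nat.mul_le_mul_right g hg
    omega
  have hdis : (𝓖 : Set (Finset ι)).PairwiseDisjoint T := by
    intro G hG G' hG' hne
    refine Finset.disjoint_left.2 fun z hz hz' => hne ?_
    exact h.eq_of_mem hG hG' (Finset.mem_product.1 (Finset.mem_filter.1 hz).1).1
      (Finset.mem_product.1 (Finset.mem_filter.1 hz').1).1
  have hle : #(𝓖.biUnion T) ≤ #(groupPairs c 𝓕 𝓖) := by
    refine card_le_card fun z hz => ?_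
    obtain ⟨G, hG, hz⟩ := Finset.mem_biUnion.1 hz
    obtain ⟨h1, h2⟩ := Finset.mem_filter.1 hz
    obtain ⟨h3, h4⟩ := Finset.mem_product.1 h1
    exact Finset.mem_filter.2 ⟨Finset.mem_product.2 ⟨h.subset G hG h3, h.subset G hG h4⟩,
      ⟨G, hG, h3, h4⟩, h2⟩
  rw [Finset.card_biUnion hdis] at hle
  have h2 := Finset.card_nsmul_le_sum 𝓖 (fun G => #(T G) * 4) (g * g) hT
  rw [← Finset.sum_mul, smul_eq_mul] at h2
  omega

theorem exists_injective_image_eq [DecidableEq V] {s : Finset V} {m : ℕ} (hs : #s = m) :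
    ∃ f : Fin m → V, Function.Injective f ∧ univ.image f = s := by
  refine ⟨fun r => ((Finset.equivFinOfCardEq hs).symm r : V),
    Subtype.val_injective.comp (Equiv.injective _), ?_⟩
  ext v
  simp only [mem_image, mem_univ, true_and]
  constructor
  · rintro ⟨r, rfl⟩
    exact Subtype.prop _
  · intro hv
    exact ⟨Finset.equivFinOfCardEq hs ⟨v, hv⟩, by simp⟩

theorem card_color_le [Fintype V] (hne : ∀ i, (e i).Nonempty)
    (hdisj : ∀ i i', c i = c i' → i ≠ i' → Disjoint (e i) (e i')) (j : ℕ) (D : Finset ι)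
    (hD : ∀ i ∈ D, c i = j) : #D ≤ Fintype.card V := by
  choose v hv using hne
  rw [← Finset.card_univ]
  refine Finset.card_le_card_of_injOn v (fun _ _ => mem_univ _) fun i hi i' hi' hvv => ?_
  by_contra hii
  exact Finset.disjoint_left.1 (hdisj i i' ((hD i hi).trans (hD i' hi').symm) hii) (hv i)
    (hvv ▸ hv i')

variable [Fintype V] [DecidableEq V]

/-- If `R` meets `J`, a shared vertex of equally coloured first hyperedges forces them to coincide,
so `w.2` lies in the same group and contains the core as well as the vertices from `R \ J`. If `R`
avoids `J`, then `w.2` determines its group and, by colour, `w.1`; for empty `R` one counts at most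
n first hyperedges with g partners each. -/
theorem IsGrouping.card_overlap_le (h : IsGrouping e 𝓕 t g 𝓖) {q m : ℕ} {p lam : ℝ} (ht : 1 ≤ t)
    (hm : t + m = q) (hp0 : 0 < p) (hp1 : p ≤ 1)
    (hpq : 1 ≤ (Fintype.card V : ℝ) ^ 2 * p ^ q) (hlam : 0 < lam)
    (hcard : ∀ i, #(e i) = q)
    (hdisj : ∀ i i', c i = c i' → i ≠ i' → Disjoint (e i) (e i'))
    (hdeg : ∀ R : Finset V, R.Nonempty →
      (#{i ∈ 𝓕 | R ⊆ e i} : ℝ) ≤ 2 * lam * degreeScale (Fintype.card V) p #R)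
    (hg : lam * degreeScale (Fintype.card V) p t ≤ g)
    {Q : ι → Finset V} (hQ : ∀ G ∈ 𝓖, ∀ i ∈ G, #(Q i) = t ∧ ∀ i' ∈ G, Q i ⊆ e i')
    {f : ι → Fin m → V} (hfi : ∀ G ∈ 𝓖, ∀ i ∈ G, Function.Injective (f i))
    (hfe : ∀ G ∈ 𝓖, ∀ i ∈ G, ∀ r, f i r ∈ e i) (hfQ : ∀ G ∈ 𝓖, ∀ i ∈ G, ∀ r, f i r ∉ Q i)
    {J : Finset (Fin m)} (hJ : 2 * #J ≤ q) (hJ' : 2 * #Jᶜ ≤ q) {z : ι × ι}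
    (hz : z ∈ groupPairs c 𝓕 𝓖) (R : Finset (Fin m)) :
    (#{w ∈ groupPairs c 𝓕 𝓖 | c w.1 = c z.1 ∧ ∀ r ∈ R, mixed f J z r = mixed f J w r} : ℝ) ≤
      2 * Fintype.card V * g * p ^ #R := by
  set n := Fintype.card V
  set A := {w ∈ groupPairs c 𝓕 𝓖 | c w.1 = c z.1 ∧ ∀ r ∈ R, mixed f J z r = mixed f J w r}
  have hlamg : lam ≤ g :=
    (le_mul_of_one_le_right hlam.le (one_le_degreeScale n p t)).trans hg
  obtain ⟨-, ⟨G, hG, hz1, hz2⟩, hzc⟩ := Finset.mem_filter.1 hz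
  have hA : ∀ w ∈ A, (∃ G ∈ 𝓖, w.1 ∈ G ∧ w.2 ∈ G) ∧ c w.1 = c z.1 ∧
      ∀ r ∈ R, mixed f J z r = mixed f J w r := by
    intro w hw
    obtain ⟨h1, h2⟩ := Finset.mem_filter.1 hw
    exact ⟨(Finset.mem_filter.1 h1).2.1, h2⟩
  by_cases hRJ : ∃ r ∈ R, r ∈ J
  · obtain ⟨r₀, hr₀, hr₀J⟩ := hRJ
    have hfst : ∀ w ∈ A, w.1 = z.1 ∧ w.2 ∈ G := by
      intro w hw
      obtain ⟨⟨G', hG', h1, h2⟩, h3, h4⟩ := hA w hw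
      have h5 := h4 r₀ hr₀
      simp only [mixed, hr₀J, if_true] at h5
      have h6 : w.1 = z.1 := by
        by_contra hne
        exact Finset.disjoint_left.1 (hdisj _ _ h3 hne) (hfe G' hG' _ h1 r₀)
          (h5 ▸ hfe G hG _ hz1 r₀)
      refine ⟨h6, ?_⟩
      rw [h6] at h1
      rwa [h.eq_of_mem hG hG' hz1 h1]
    set B : Finset V := Q z.2 ∪ (R \ J).image (f z.2) with hB
    have hBcard : #B = t + #(R \ J) := by
      rw [hB, Finset.card_union_of_disjoint, (hQ G hG _ hz2).1,
        Finset.card_image_of_injective _ (hfi G hG _ hz2)]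
      refine Finset.disjoint_left.2 fun v hv hv' => ?_
      obtain ⟨r, -, rfl⟩ := Finset.mem_image.1 hv'
      exact hfQ G hG _ hz2 r hv
    have hle : #A ≤ #{i ∈ 𝓕 | B ⊆ e i} := by
      refine Finset.card_le_card_of_injOn Prod.snd (fun w hw => ?_) fun w hw w' hw' hww =>
        Prod.ext ((hfst w hw).1.trans (hfst w' hw').1.symm) hww
      have hwG := (hfst w hw).2
      refine Finset.mem_coe.2 (Finset.mem_filter.2 ⟨h.subset G hG hwG, Finset.union_subset ?_ ?_⟩)
      · exact (hQ G hG _ hz2).2 _ hwG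
      · intro v hv
        obtain ⟨r, hr, rfl⟩ := Finset.mem_image.1 hv
        obtain ⟨hrR, hrJ⟩ := Finset.mem_sdiff.1 hr
        have h5 := (hA w hw).2.2 r hrR
        simp only [mixed, hrJ, if_false] at h5
        rw [h5]
        exact hfe G hG _ hwG r
    have hBne : B.Nonempty := Finset.card_pos.1 (by omega)
    have h1 : (#A : ℝ) ≤ 2 * lam * degreeScale n p (t + #(R \ J)) := by
      rw [← hBcard]
      exact le_trans (by exact_mod_cast hle) (hdeg B hBne)
    refine h1.trans ?_
    rw [mul_assoc 2, mul_assoc 2, mul_assoc 2]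
    refine mul_le_mul_of_nonneg_left ?_ (by norm_num)
    rw [degreeScale, mul_max_of_nonneg _ _ hlam.le, mul_one]
    have hnp : lam * (n * p ^ t) ≤ g :=
      (mul_le_mul_of_nonneg_left (le_max_right _ _) hlam.le).trans hg
    -- Where the degree scale is 1, the full n²p^q ≥ 1 is spent; otherwise n p^|R ∩ J| ≥ 1 suffices.
    refine max_le ?_ ?_
    · have hRm : p ^ m ≤ p ^ #R := pow_le_pow_of_le_one hp0.le hp1
        ((card_le_univ R).trans (Fintype.card_fin m).le)
      calc lam ≤ lam * ((n : ℝ) ^ 2 * p ^ q) := le_mul_of_one_le_right hlam.le hpq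
        _ = n * (lam * (n * p ^ t)) * p ^ m := by rw [← hm, pow_add]; ring
        _ ≤ n * g * p ^ #R := by gcongr
    · have hsplit : #R = #(R ∩ J) + #(R \ J) := (Finset.card_inter_add_card_sdiff R J).symm
      have h2 : 1 ≤ n * p ^ #(R ∩ J) := one_le_mul_pow_of_two_mul_le hp0.le hp1 hpq
        (by have := card_le_card (inter_subset_right : R ∩ J ⊆ J); omega)
      calc lam * (n * p ^ (t + #(R \ J))) = lam * (n * p ^ t) * p ^ #(R \ J) := by
            rw [pow_add]; ring
        _ ≤ g * p ^ #(R \ J) := by gcongr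
        _ ≤ (n * p ^ #(R ∩ J)) * (g * p ^ #(R \ J)) :=
            le_mul_of_one_le_left (by positivity) h2
        _ = n * g * p ^ #R := by rw [hsplit, pow_add]; ring
  · push Not at hRJ
    rcases R.eq_empty_or_nonempty with rfl | hRne
    · have h1 : #A ≤ g * #(A.image Prod.fst) := by
        refine Finset.card_le_mul_card_image A g fun d hd => ?_
        obtain ⟨w₀, hw₀, rfl⟩ := Finset.mem_image.1 hd
        obtain ⟨⟨G', hG', h1, h2⟩, -⟩ := hA w₀ hw₀
        rw [← h.card G' hG']
        refine Finset.card_le_card_of_injOn Prod.snd (fun w hw => ?_) fun w hw w' hw' hww =>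
          Prod.ext ((Finset.mem_filter.1 hw).2.trans (Finset.mem_filter.1 hw').2.symm) hww
        obtain ⟨hwA, hw1⟩ := Finset.mem_filter.1 hw
        obtain ⟨⟨G'', hG'', h1', h2'⟩, -⟩ := hA w hwA
        rw [hw1] at h1'
        rwa [h.eq_of_mem hG' hG'' h1 h1']
      have h2 : #(A.image Prod.fst) ≤ n := by
        refine card_color_le (fun i => Finset.card_pos.1 (by rw [hcard]; omega)) hdisj (c z.1) _
          fun i hi => ?_
        obtain ⟨w, hw, rfl⟩ := Finset.mem_image.1 hi
        exact (hA w hw).2.1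
      have h3 : (#A : ℝ) ≤ g * n := by
        exact_mod_cast h1.trans (Nat.mul_le_mul_left g h2)
      have h4 : (0 : ℝ) ≤ g * n := by positivity
      rw [card_empty, pow_zero]
      linarith
    · set B : Finset V := R.image (f z.2) with hB
      have hBcard : #B = #R := Finset.card_image_of_injective _ (hfi G hG _ hz2)
      have hle : #A ≤ #{i ∈ 𝓕 | B ⊆ e i} := by
        refine Finset.card_le_card_of_injOn Prod.snd (fun w hw => ?_) fun w hw w' hw' hww => ?_
        · obtain ⟨⟨G', hG', h1, h2⟩, h3, h4⟩ := hA w hw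
          refine Finset.mem_coe.2 (Finset.mem_filter.2 ⟨h.subset G' hG' h2, fun v hv => ?_⟩)
          obtain ⟨r, hr, rfl⟩ := Finset.mem_image.1 hv
          have h5 := h4 r hr
          simp only [mixed, hRJ r hr, if_false] at h5
          rw [h5]
          exact hfe G' hG' _ h2 r
        · obtain ⟨⟨G', hG', h1, h2⟩, h3, -⟩ := hA w hw
          obtain ⟨⟨G'', hG'', h1', h2'⟩, h3', -⟩ := hA w' hw'
          refine Prod.ext ?_ hww
          rw [← hww] at h2'
          obtain rfl := h.eq_of_mem hG' hG'' h2 h2'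
          exact h.eq_of_color_eq ht hdisj hG' h1 h1' (h3.trans h3'.symm)
      have h1 : (#A : ℝ) ≤ 2 * lam * degreeScale n p #R := by
        rw [← hBcard]
        exact le_trans (by exact_mod_cast hle) (hdeg B (hRne.image _))
      have h2 : 1 ≤ n * p ^ #R := one_le_mul_pow_of_two_mul_le hp0.le hp1 hpq (by
        have : R ⊆ Jᶜ := fun r hr => Finset.mem_compl.2 (hRJ r hr)
        have := card_le_card this
        omega)
      rw [degreeScale, max_eq_right h2] at h1
      refine h1.trans ?_
      calc 2 * lam * (n * p ^ #R) ≤ 2 * g * (n * p ^ #R) := by gcongr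
        _ = _ := by ring

/-- In a family of hyperedges without sets of degree above `2 λ · degreeScale`, the groups of
size at least `λ · degreeScale` cover few hyperedges. -/
theorem IsGrouping.card_mul_le (h : IsGrouping e 𝓕 t g 𝓖) (x : V → ℕ → ℤˣ) {k q ℓ : ℕ}
    {p lam : ℝ} (ht : 1 ≤ t) (htq : t ≤ q) (hp0 : 0 < p) (hp1 : p ≤ 1)
    (hpdef : p = (ℓ : ℝ) / Fintype.card V)
    (hpq : 1 ≤ (Fintype.card V : ℝ) ^ 2 * p ^ q) (hlam : 1 < lam)
    (hcard : ∀ i, #(e i) = q)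
    (hdisj : ∀ i i', c i = c i' → i ≠ i' → Disjoint (e i) (e i'))
    (hck : ∀ i, c i < k) (hxe : ∀ i, ∏ v ∈ e i, x v = Pi.mulSingle (c i) (-1))
    (hdeg : ∀ R : Finset V, R.Nonempty →
      (#{i ∈ 𝓕 | R ⊆ e i} : ℝ) ≤ 2 * lam * degreeScale (Fintype.card V) p #R)
    (hg : lam * degreeScale (Fintype.card V) p t ≤ g) :
    (#𝓖 : ℝ) * g * Real.log 2 ≤
      128 * 2 ^ q * q * (Fintype.card V * (ℓ * Real.log (Fintype.card V))) := by
  set n := Fintype.card V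
  have hn : 0 < (n : ℝ) := by
    rcases (Nat.cast_nonneg (α := ℝ) n).eq_or_lt with h | h
    · rw [← h] at hpdef; simp at hpdef; linarith
    · exact h
  have hlamg : lam ≤ g :=
    (le_mul_of_one_le_right (by linarith) (one_le_degreeScale n p t)).trans hg
  have hg2 : 2 ≤ g := by
    have : (1 : ℝ) < g := hlam.trans_le hlamg
    exact_mod_cast this
  obtain ⟨m, hm⟩ : ∃ m, t + m = q := ⟨q - t, by omega⟩
  -- The groups are disjoint, so a core can be attached to each hyperedge consistently within its
  -- group.
  have hex : ∀ i, ∃ Q : Finset V, ∀ G ∈ 𝓖, i ∈ G →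
      Q = if hG : G ∈ 𝓖 then (h.core G hG).choose else ∅ := by
    intro i
    by_cases hi : ∃ G ∈ 𝓖, i ∈ G
    · obtain ⟨G, hG, hiG⟩ := hi
      refine ⟨if hG : G ∈ 𝓖 then (h.core G hG).choose else ∅, fun G' hG' hiG' => ?_⟩
      rw [← h.eq_of_mem hG hG' hiG hiG']
    · push Not at hi
      exact ⟨∅, fun G hG hiG => absurd hiG (hi G hG)⟩
  choose Q hQdef using hex
  have hQG : ∀ G ∈ 𝓖, ∀ i ∈ G, ∀ i' ∈ G, Q i = Q i' := fun G hG i hi i' hi' =>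
    (hQdef i G hG hi).trans (hQdef i' G hG hi').symm
  have hQ : ∀ G ∈ 𝓖, ∀ i ∈ G, #(Q i) = t ∧ ∀ i' ∈ G, Q i ⊆ e i' := by
    intro G hG i hi
    rw [hQdef i G hG hi, dif_pos hG]
    exact (h.core G hG).choose_spec
  have hfex : ∀ i, ∃ f : Fin m → V, #(e i \ Q i) = m →
      Function.Injective f ∧ univ.image f = e i \ Q i := by
    intro i
    by_cases hi : #(e i \ Q i) = m
    · obtain ⟨f, hf⟩ := exists_injective_image_eq hi
      exact ⟨f, fun _ => hf⟩
    · have : Nonempty (Fin m → V) := by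
        have : 0 < n := by exact_mod_cast hn
        obtain ⟨v⟩ := Fintype.card_pos_iff.1 this
        exact ⟨fun _ => v⟩
      exact ⟨this.some, fun h => absurd h hi⟩
  choose f hf using hfex
  have hf' : ∀ G ∈ 𝓖, ∀ i ∈ G, Function.Injective (f i) ∧ univ.image (f i) = e i \ Q i := by
    intro G hG i hi
    refine hf i ?_
    rw [Finset.card_sdiff_of_subset ((hQ G hG i hi).2 i hi), hcard, (hQ G hG i hi).1]
    omega
  have hfmem : ∀ G ∈ 𝓖, ∀ i ∈ G, ∀ r, f i r ∈ e i \ Q i := fun G hG i hi r => by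
    rw [← (hf' G hG i hi).2]
    exact Finset.mem_image_of_mem _ (mem_univ r)
  have hoverlap := fun (J : Finset (Fin m)) (hJ : 2 * #J ≤ q) (hJ' : 2 * #Jᶜ ≤ q) z
      (hz : z ∈ groupPairs c 𝓕 𝓖) =>
    h.card_overlap_le ht hm hp0 hp1 hpq (by linarith) hcard hdisj hdeg hg hQ
      (fun G hG i hi => (hf' G hG i hi).1)
      (fun G hG i hi r => (Finset.mem_sdiff.1 (hfmem G hG i hi r)).1)
      (fun G hG i hi r => (Finset.mem_sdiff.1 (hfmem G hG i hi r)).2) hJ hJ' hz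
  -- As t ≥ 1, m ≤ q - 1, so both halves of a nearly balanced split have size at most q/2.
  obtain ⟨I, -, hI⟩ := Finset.exists_subset_card_eq (s := (univ : Finset (Fin m))) (n := m / 2)
    (by rw [Finset.card_univ, Fintype.card_fin]; omega)
  have hIc : #Iᶜ = m - m / 2 := by rw [Finset.card_compl, hI, Fintype.card_fin]
  have hsq : ∀ y : ℕ → ℤˣ, y * y = 1 := fun y => funext fun j => by
    rw [Pi.mul_apply, ← sq, Int.units_sq, Pi.one_apply]
  have hg0 : (0 : ℝ) < g := by linarith
  have hmain := card_pairs_mul_log_two_le (ℓ := ℓ) c f (groupPairs c 𝓕 𝓖) x (k := k) hp0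
    (K := 2 * n * g) (by positivity) hpdef I
    (fun z hz => ⟨(Finset.mem_filter.1 hz).2.2, hck _⟩)
    (fun z hz => by
      obtain ⟨-, ⟨G, hG, hz1, hz2⟩, -⟩ := Finset.mem_filter.1 hz
      have hprod : ∀ i ∈ G, ∏ r, x (f i r) = (∏ v ∈ Q z.1, x v) * Pi.mulSingle (c i) (-1) := by
        intro i hi
        have hsub : Q i ⊆ e i := (hQ G hG i hi).2 i hi
        rw [← hxe i, ← Finset.prod_sdiff hsub, ← (hf' G hG i hi).2,
          Finset.prod_image (hf' G hG i hi).1.injOn, hQG G hG _ hz1 i hi, mul_left_comm, hsq,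
          mul_one]
      rw [hprod _ hz1, hprod _ hz2, mul_mul_mul_comm, hsq, one_mul])
    (hoverlap I (by omega) (by omega))
    (hoverlap Iᶜ (by omega) (by rw [compl_compl]; omega))
  have hcount : (#𝓖 : ℝ) * (g * g) ≤ 4 * #(groupPairs c 𝓕 𝓖) := by
    exact_mod_cast h.card_mul_sq_le ht hg2 hdisj
  have hlog2 : 0 ≤ Real.log 2 := Real.log_nonneg (by norm_num)
  have hlogn : 0 ≤ Real.log n := Real.log_natCast_nonneg n
  have hmq : (m : ℝ) ≤ q := by exact_mod_cast (by omega : m ≤ q)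
  have hmq2 : (2 : ℝ) ^ m ≤ 2 ^ q := pow_le_pow_right₀ (by norm_num) (by omega)
  refine le_of_mul_le_mul_right ?_ hg0
  calc (#𝓖 : ℝ) * g * Real.log 2 * g = (#𝓖 : ℝ) * (g * g) * Real.log 2 := by ring
    _ ≤ 4 * #(groupPairs c 𝓕 𝓖) * Real.log 2 := by gcongr
    _ = 4 * (#(groupPairs c 𝓕 𝓖) * Real.log 2) := by ring
    _ ≤ 4 * (16 * 2 ^ m * (2 * n * g) * (m * (ℓ * Real.log n))) := by gcongr
    _ ≤ 4 * (16 * 2 ^ q * (2 * n * g) * (q * (ℓ * Real.log n))) := by gcongr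
    _ = _ := by ring

end Groups

/-! ### Removing groupings scale by scale -/

section Extraction

variable {V ι : Type*} [DecidableEq V] [DecidableEq ι] {e : ι → Finset V}

theorem exists_maximal_isGrouping (e : ι → Finset V) (𝓕 : Finset ι) (t : ℕ) {g : ℕ} (hg : 1 ≤ g) :
    ∃ 𝓖, IsGrouping e 𝓕 t g 𝓖 ∧
      ∀ Q : Finset V, #Q = t → #{i ∈ 𝓕 \ 𝓖.biUnion id | Q ⊆ e i} < g := by
  classical
  let P : Finset (Finset (Finset ι)) := {𝓖 ∈ 𝓕.powerset.powerset | IsGrouping e 𝓕 t g 𝓖}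
  obtain ⟨𝓖, h𝓖P, hmax⟩ := P.exists_max_image card
    ⟨∅, Finset.mem_filter.2 ⟨by simp, ⟨by simp, by simp, by simp, by simp⟩⟩⟩
  have h𝓖 := (Finset.mem_filter.1 h𝓖P).2
  refine ⟨𝓖, h𝓖, fun Q hQ => ?_⟩
  by_contra! hle
  obtain ⟨G, hG, hGcard⟩ := Finset.exists_subset_card_eq hle
  have hGmem : ∀ i ∈ G, i ∈ 𝓕 ∧ i ∉ 𝓖.biUnion id ∧ Q ⊆ e i := fun i hi => by
    obtain ⟨h1, h2⟩ := Finset.mem_filter.1 (hG hi)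
    exact ⟨(Finset.mem_sdiff.1 h1).1, (Finset.mem_sdiff.1 h1).2, h2⟩
  have hdis : ∀ G' ∈ 𝓖, Disjoint G G' := fun G' hG' => Finset.disjoint_left.2 fun i hi hi' =>
    (hGmem i hi).2.1 (Finset.mem_biUnion.2 ⟨G', hG', hi'⟩)
  have hGnot : G ∉ 𝓖 := fun h => by
    have := hdis G h
    rw [disjoint_self, Finset.bot_eq_empty] at this
    rw [this, card_empty] at hGcard
    omega
  have hins : IsGrouping e 𝓕 t g (insert G 𝓖) := by
    refine ⟨?_, ?_, ?_, ?_⟩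
    · exact Finset.forall_mem_insert _ _ _ |>.2 ⟨fun i hi => (hGmem i hi).1, h𝓖.subset⟩
    · exact Finset.forall_mem_insert _ _ _ |>.2 ⟨hGcard, h𝓖.card⟩
    · exact Finset.forall_mem_insert _ _ _ |>.2 ⟨⟨Q, hQ, fun i hi => (hGmem i hi).2.2⟩, h𝓖.core⟩
    · rw [Finset.coe_insert, Set.pairwiseDisjoint_insert]
      exact ⟨h𝓖.disjoint, fun G' hG' _ => hdis G' hG'⟩
  have := hmax (insert G 𝓖) (Finset.mem_filter.2 ⟨by
    rw [Finset.mem_powerset]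
    exact fun G' hG' => Finset.mem_powerset.2 (hins.subset G' hG'), hins⟩)
  rw [Finset.card_insert_of_notMem hGnot] at this
  omega

/-- Removing maximal groupings halves the degree bounds. -/
theorem exists_subfamily_degree_le {n q : ℕ} {p lam M : ℝ} (hlam : 1 < lam) (𝓕 : Finset ι)
    (hdeg : ∀ R : Finset V, R.Nonempty →
      (#{i ∈ 𝓕 | R ⊆ e i} : ℝ) ≤ 2 * lam * degreeScale n p #R)
    (hM : ∀ (𝓕' : Finset ι) (t g : ℕ) (𝓖 : Finset (Finset ι)), 1 ≤ t → t ≤ q →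
      (∀ R : Finset V, R.Nonempty →
        (#{i ∈ 𝓕' | R ⊆ e i} : ℝ) ≤ 2 * lam * degreeScale n p #R) →
      lam * degreeScale n p t ≤ g → IsGrouping e 𝓕' t g 𝓖 → (#𝓖 : ℝ) * g ≤ M)
    (s : ℕ) (hs : s ≤ q) :
    ∃ 𝓕' ⊆ 𝓕, (#𝓕 : ℝ) ≤ #𝓕' + s * M ∧ ∀ R : Finset V, R.Nonempty → #R ≤ s →
      (#{i ∈ 𝓕' | R ⊆ e i} : ℝ) ≤ lam * degreeScale n p #R := by
  induction s with
  | zero =>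
    refine ⟨𝓕, subset_rfl, by simp, fun R hR h => ?_⟩
    have := hR.card_pos
    omega
  | succ s ih =>
    obtain ⟨𝓕', hsub, hcard, hlow⟩ := ih (by omega)
    -- With the ceiling, fewer than `g` remaining hyperedges on a core is exactly the halved degree
    -- bound.
    set g := ⌈lam * degreeScale n p (s + 1)⌉₊ with hg
    have hpos : 0 < lam * degreeScale n p (s + 1) :=
      mul_pos (by linarith) (zero_lt_one.trans_le (one_le_degreeScale _ _ _))
    obtain ⟨𝓖, h𝓖, hrest⟩ := exists_maximal_isGrouping e 𝓕' (s + 1) (g := g)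
      (Nat.ceil_pos.2 hpos)
    have hmono : ∀ {A B : Finset ι} (R : Finset V), A ⊆ B →
        (#{i ∈ A | R ⊆ e i} : ℝ) ≤ #{i ∈ B | R ⊆ e i} := fun R hAB => by
      exact_mod_cast card_le_card (Finset.filter_subset_filter _ hAB)
    have hbound := hM 𝓕' (s + 1) g 𝓖 (by omega) hs
      (fun R hR => (hmono R hsub).trans (hdeg R hR)) (Nat.le_ceil _) h𝓖
    refine ⟨𝓕' \ 𝓖.biUnion id, sdiff_subset.trans hsub, ?_, fun R hR hRs => ?_⟩
    · have h1 : #(𝓖.biUnion id) ≤ #𝓖 * g :=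
        Finset.card_biUnion_le_card_mul _ _ _ fun G hG => (h𝓖.card G hG).le
      have h2 : #𝓕' ≤ #(𝓕' \ 𝓖.biUnion id) + #𝓖 * g := by
        have := Finset.card_le_card_sdiff_add_card (s := 𝓕') (t := 𝓖.biUnion id)
        omega
      have h3 : (#𝓕' : ℝ) ≤ #(𝓕' \ 𝓖.biUnion id) + #𝓖 * g := by exact_mod_cast h2
      push_cast
      linarith
    · rcases hRs.lt_or_eq with h | h
      · exact (hmono R sdiff_subset).trans (hlow R hR (by omega))
      · rw [h]
        exact (Nat.lt_ceil.1 (hrest R h)).le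

variable [Fintype V]

/-- A bound on the number of hyperedges covered by groupings at all levels bounds the number of
all hyperedges. -/
theorem card_le_of_grouping_bound {q : ℕ} {p M : ℝ} (hq : 1 ≤ q) (hcard : ∀ i, #(e i) = q)
    (hM : ∀ lam : ℝ, 1 < lam → ∀ (𝓕' : Finset ι) (t g : ℕ) (𝓖 : Finset (Finset ι)),
      1 ≤ t → t ≤ q → (∀ R : Finset V, R.Nonempty →
        (#{i ∈ 𝓕' | R ⊆ e i} : ℝ) ≤ 2 * lam * degreeScale (Fintype.card V) p #R) →
      lam * degreeScale (Fintype.card V) p t ≤ g → IsGrouping e 𝓕' t g 𝓖 → (#𝓖 : ℝ) * g ≤ M)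
    (a : ℕ) : ∀ 𝓕 : Finset ι, (∀ R : Finset V, R.Nonempty →
      (#{i ∈ 𝓕 | R ⊆ e i} : ℝ) ≤ 2 ^ (a + 1) * degreeScale (Fintype.card V) p #R) →
    (#𝓕 : ℝ) ≤ a * (q * M) + 2 * Fintype.card V * degreeScale (Fintype.card V) p 1 := by
  induction a with
  | zero =>
    intro 𝓕 hdeg
    have hsub : 𝓕 ⊆ (univ : Finset V).biUnion fun v => {i ∈ 𝓕 | {v} ⊆ e i} := by
      intro i hi
      obtain ⟨v, hv⟩ : (e i).Nonempty := Finset.card_pos.1 (by rw [hcard]; omega)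
      exact Finset.mem_biUnion.2 ⟨v, mem_univ _, Finset.mem_filter.2
        ⟨hi, Finset.singleton_subset_iff.2 hv⟩⟩
    have h1 : (#𝓕 : ℝ) ≤ ∑ v : V, (#{i ∈ 𝓕 | {v} ⊆ e i} : ℝ) := by
      exact_mod_cast (card_le_card hsub).trans card_biUnion_le
    have h2 : ∀ v ∈ (univ : Finset V), (#{i ∈ 𝓕 | {v} ⊆ e i} : ℝ) ≤
        2 * degreeScale (Fintype.card V) p 1 := fun v _ => by
      simpa using hdeg {v} (singleton_nonempty v)
    have h3 := h1.trans (Finset.sum_le_sum h2)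
    rw [Finset.sum_const, nsmul_eq_mul, Finset.card_univ] at h3
    simp only [Nat.cast_zero, zero_mul, zero_add]
    linarith
  | succ a ih =>
    intro 𝓕 hdeg
    have hlam : (1 : ℝ) < 2 ^ (a + 1) := one_lt_pow₀ (by norm_num) (by omega)
    obtain ⟨𝓕', -, h1, h2⟩ := exists_subfamily_degree_le hlam 𝓕
      (fun R hR => (hdeg R hR).trans_eq (by rw [pow_succ' (2 : ℝ) (a + 1)]))
      (hM _ hlam) q le_rfl
    have h3 := ih 𝓕' fun R hR => by
      by_cases hRq : #R ≤ q
      · exact h2 R hR hRq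
      · have : ({i ∈ 𝓕' | R ⊆ e i} : Finset ι) = ∅ :=
          Finset.filter_eq_empty_iff.2 fun i _ hsub => hRq ((card_le_card hsub).trans (hcard i).le)
        rw [this, card_empty, Nat.cast_zero]
        exact mul_nonneg (by positivity) (zero_le_one.trans (one_le_degreeScale _ _ _))
    push_cast
    linarith

/-- Matchings of `q`-sets that span distinct basis vectors have few hyperedges altogether. -/
theorem card_hyperedges_le [Fintype ι] {c : ι → ℕ} (x : V → ℕ → ℤˣ) {k q ℓ : ℕ} (hq : 1 ≤ q)
    (hℓ : 1 ≤ ℓ) (hℓV : ℓ ≤ Fintype.card V) (hk : k ≤ Fintype.card V)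
    (hpq : 1 ≤ (Fintype.card V : ℝ) ^ 2 * (ℓ / Fintype.card V) ^ q)
    (hcard : ∀ i, #(e i) = q)
    (hdisj : ∀ i i', c i = c i' → i ≠ i' → Disjoint (e i) (e i'))
    (hck : ∀ i, c i < k) (hxe : ∀ i, ∏ v ∈ e i, x v = Pi.mulSingle (c i) (-1)) :
    (Fintype.card ι : ℝ) ≤ Nat.log 2 (Fintype.card V) * (q * (128 * 2 ^ q * q *
      (Fintype.card V * (ℓ * Real.log (Fintype.card V))) / Real.log 2)) +
      2 * Fintype.card V * ℓ := by
  have hV : (0 : ℝ) < Fintype.card V := by exact_mod_cast (by omega : 0 < Fintype.card V)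
  have hℓ0 : (0 : ℝ) < ℓ := by exact_mod_cast hℓ
  set p : ℝ := ℓ / Fintype.card V with hp
  have hp0 : 0 < p := by positivity
  have hp1 : p ≤ 1 := by rw [hp, div_le_one hV]; exact_mod_cast hℓV
  have hscale : degreeScale (Fintype.card V) p 1 = ℓ := by
    rw [degreeScale, pow_one, hp, mul_div_cancel₀ _ hV.ne', max_eq_right]
    exact_mod_cast hℓ
  have h := card_le_of_grouping_bound (p := p) hq hcard
    (fun lam hlam 𝓕' t g 𝓖 ht htq hdeg hg h𝓖 => by
      have := h𝓖.card_mul_le x ht htq hp0 hp1 hp hpq hlam hcard hdisj hck hxe hdeg hg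
      rwa [← le_div_iff₀ (Real.log_pos (by norm_num))] at this)
    (Nat.log 2 (Fintype.card V)) univ fun R hR => by
      obtain ⟨v, hv⟩ := hR
      -- Hyperedges through one vertex have distinct colours; this bounds the starting scale by k ≤
      -- n.
      have h1 : #{i : ι | R ⊆ e i} ≤ k := by
        rw [← Finset.card_range k]
        refine Finset.card_le_card_of_injOn c (fun i _ => Finset.mem_coe.2 (mem_range.2 (hck i)))
          fun i hi i' hi' hii => ?_
        by_contra hne
        exact Finset.disjoint_left.1 (hdisj i i' hii hne) ((Finset.mem_filter.1 hi).2 hv)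
          ((Finset.mem_filter.1 hi').2 hv)
      have h2 : #{i : ι | R ⊆ e i} ≤ 2 ^ (Nat.log 2 (Fintype.card V) + 1) :=
        (h1.trans hk).trans (Nat.lt_pow_succ_log_self (by norm_num) _).le
      calc (#{i : ι | R ⊆ e i} : ℝ) ≤ 2 ^ (Nat.log 2 (Fintype.card V) + 1) := by exact_mod_cast h2
        _ ≤ _ := le_mul_of_one_le_right (by positivity) (one_le_degreeScale _ _ _)
  rwa [hscale, Finset.card_univ] at h

end Extraction

/-! ### Choice of ℓ, padding and the final count -/

section Bounds

theorem card_hyperedges_le_rpow {V ι : Type*} [Fintype V] [DecidableEq V] [Fintype ι]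
    [DecidableEq ι] {e : ι → Finset V} {c : ι → ℕ} (x : V → ℕ → ℤˣ) {k q : ℕ} (hq : 3 ≤ q)
    (hV : 2 ≤ Fintype.card V) (hk : k ≤ Fintype.card V) (hcard : ∀ i, #(e i) = q)
    (hdisj : ∀ i i', c i = c i' → i ≠ i' → Disjoint (e i) (e i'))
    (hck : ∀ i, c i < k) (hxe : ∀ i, ∏ v ∈ e i, x v = Pi.mulSingle (c i) (-1)) :
    (Fintype.card ι : ℝ) ≤ 2 * (q * (128 * 2 ^ q * q) + 2) / Real.log 2 ^ 2 * Fintype.card V *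
      (Fintype.card V : ℝ) ^ (1 - 2 / (q : ℝ)) * Real.log (Fintype.card V) ^ 2 := by
  set n := Fintype.card V
  have hn : (2 : ℝ) ≤ n := by exact_mod_cast hV
  have hn0 : (0 : ℝ) < n := by linarith
  have hq3 : (3 : ℝ) ≤ q := by exact_mod_cast hq
  have hq0 : (0 : ℝ) < q := by linarith
  set y : ℝ := (n : ℝ) ^ (1 - 2 / (q : ℝ)) with hy
  have hexp0 : 0 ≤ 1 - 2 / (q : ℝ) := by
    rw [sub_nonneg, div_le_one hq0]; linarith
  have hy1 : 1 ≤ y := Real.one_le_rpow (by linarith) hexp0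
  have hyn : y ≤ n := by
    have h2q : 0 ≤ 2 / (q : ℝ) := by positivity
    calc y ≤ (n : ℝ) ^ (1 : ℝ) :=
          Real.rpow_le_rpow_of_exponent_le (by linarith) (by linarith)
      _ = n := Real.rpow_one _
  have hyq : (y / n) ^ q = ((n : ℝ) ^ 2)⁻¹ := by
    have h1 : y / n = (n : ℝ) ^ (-(2 / (q : ℝ))) := by
      rw [hy, Real.rpow_sub hn0, Real.rpow_one, Real.rpow_neg hn0.le]
      field_simp
    rw [h1, ← Real.rpow_natCast, ← Real.rpow_mul hn0.le]
    have h2 : -(2 / (q : ℝ)) * q = -((2 : ℕ) : ℝ) := by push_cast; field_simp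
    rw [h2, Real.rpow_neg hn0.le, Real.rpow_natCast]
  -- The least integer with n²(ℓ/n)^q ≥ 1.
  set ℓ := ⌈y⌉₊ with hℓ
  have hℓy : y ≤ ℓ := Nat.le_ceil y
  have hℓ2 : (ℓ : ℝ) ≤ 2 * y := by
    have := Nat.ceil_lt_add_one (zero_le_one.trans hy1)
    linarith
  have h := card_hyperedges_le x (k := k) (ℓ := ℓ) (by omega : 1 ≤ q)
    (Nat.ceil_pos.2 (by linarith)) (Nat.ceil_le.2 hyn) hk (by
      calc (1 : ℝ) = (n : ℝ) ^ 2 * (y / n) ^ q := by rw [hyq]; field_simp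
        _ ≤ (n : ℝ) ^ 2 * (ℓ / n) ^ q := by gcongr) hcard hdisj hck hxe
  refine h.trans ?_
  have hl2 : 0 < Real.log 2 := Real.log_pos (by norm_num)
  have hln : Real.log 2 ≤ Real.log n := Real.log_le_log (by norm_num) hn
  have hA : (Nat.log 2 n : ℝ) ≤ Real.log n / Real.log 2 := by
    rw [le_div_iff₀ hl2, ← Real.log_pow]
    refine Real.log_le_log (by positivity) ?_
    exact_mod_cast Nat.pow_log_le_self 2 (by omega)
  have hone : 1 ≤ Real.log n / Real.log 2 := (one_le_div hl2).2 hln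
  have hln0 : 0 ≤ Real.log n := hl2.le.trans hln
  calc (Nat.log 2 n : ℝ) * (q * (128 * 2 ^ q * q * (n * (ℓ * Real.log n)) / Real.log 2)) +
        2 * n * ℓ
      ≤ Real.log n / Real.log 2 *
          (q * (128 * 2 ^ q * q * (n * (2 * y * Real.log n)) / Real.log 2)) +
        2 * n * (2 * y) * (Real.log n / Real.log 2) ^ 2 := by
        refine add_le_add (by gcongr) ?_
        calc 2 * (n : ℝ) * ℓ ≤ 2 * n * (2 * y) := by gcongr
          _ ≤ _ := le_mul_of_one_le_right (by positivity) (one_le_pow₀ hone)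
    _ = _ := by field_simp

theorem le_of_forall_isRecoverySet {k n : ℕ} {E : (Fin k → ℤˣ) → (Fin n → ℤˣ)}
    (h : ∀ i, ∃ R, IsRecoverySet E i R) : k ≤ n := by
  have hinj : Function.Injective E := by
    intro b b' hb
    funext i
    obtain ⟨R, hR⟩ := h i
    rw [← hR b, ← hR b', hb]
  have := Fintype.card_le_of_injective E hinj
  simp only [Fintype.card_pi, Fintype.card_units_int, prod_const, card_univ,
    Fintype.card_fin] at this
  exact (Nat.pow_le_pow_iff_right (by norm_num)).1 this

/-- Recovery sets are padded to size exactly q with trivially labelled dummy vertices attached to a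
chosen element. Disjoint sets have different chosen elements, so matchings survive, at the price of
(q+1)n vertices. -/
theorem sum_card_matchings_le {k n q : ℕ} {E : (Fin k → ℤˣ) → (Fin n → ℤˣ)} (hq : 3 ≤ q)
    (hn : 2 ≤ n) (hkn : k ≤ n) (M : Fin k → Finset (Finset (Fin n)))
    (hM : ∀ i, ∀ R ∈ M i, #R ≤ q ∧ IsRecoverySet E i R)
    (hdis : ∀ i, (M i : Set (Finset (Fin n))).PairwiseDisjoint id) :
    ∑ i, (#(M i) : ℝ) ≤ 2 * (q * (128 * 2 ^ q * q) + 2) / Real.log 2 ^ 2 *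
      ((q + 1) * n : ℝ) * ((q + 1) * n : ℝ) ^ (1 - 2 / (q : ℝ)) *
      Real.log ((q + 1) * n : ℝ) ^ 2 := by
  have hne : ∀ i, ∀ R ∈ M i, R.Nonempty := by
    intro i R hR
    by_contra h
    rw [Finset.not_nonempty_iff_eq_empty] at h
    subst h
    have := (hM i _ hR).2 (fun _ => -1)
    simp at this
  let ι := Σ i : Fin k, {R // R ∈ M i}
  have hv : ∀ z : ι, ∃ v, v ∈ z.2.1 := fun z => hne z.1 z.2.1 z.2.2
  choose v hv using hv
  have hS : ∀ z : ι, ∃ S : Finset (Fin q), #S = q - #z.2.1 := fun z => by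
    obtain ⟨S, -, hS⟩ := Finset.exists_subset_card_eq (s := (univ : Finset (Fin q)))
      (n := q - #z.2.1) (by simp)
    exact ⟨S, hS⟩
  choose S hS using hS
  let e : ι → Finset (Fin n ⊕ (Fin n × Fin q)) := fun z => z.2.1.disjSum ({v z} ×ˢ S z)
  -- Columns of the generator matrix; the recovery identity on basis messages gives the required
  -- products.
  let x : Fin n ⊕ (Fin n × Fin q) → ℕ → ℤˣ :=
    Sum.elim (fun j s => if h : s < k then E (Pi.mulSingle ⟨s, h⟩ (-1)) j else 1) 1
  have hcardV : Fintype.card (Fin n ⊕ (Fin n × Fin q)) = (q + 1) * n := by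
    simp; ring
  have hnV : n ≤ (q + 1) * n := Nat.le_mul_of_pos_left n (by omega)
  have h := card_hyperedges_le_rpow (e := e) (c := fun z => (z.1 : ℕ)) x hq
    (by rw [hcardV]; omega) (by rw [hcardV]; omega : k ≤ _)
    (fun z => by
      have := (hM z.1 _ z.2.2).1
      simp only [e, card_disjSum, card_product, card_singleton, hS, one_mul]
      omega)
    (by
      rintro ⟨i, R, hR⟩ ⟨i', R', hR'⟩ hc hne'
      obtain rfl : i = i' := Fin.ext hc
      have hRR : R ≠ R' := fun h => hne' (by subst h; rfl)
      have hd : Disjoint R R' := hdis i hR hR' hRR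
      refine Finset.disjoint_left.2 ?_
      rintro (j | ⟨j, s⟩) h1 h2
      · exact Finset.disjoint_left.1 hd (Finset.inl_mem_disjSum.1 h1) (Finset.inl_mem_disjSum.1 h2)
      · have h3 := (Finset.mem_product.1 (Finset.inr_mem_disjSum.1 h1)).1
        have h4 := (Finset.mem_product.1 (Finset.inr_mem_disjSum.1 h2)).1
        rw [Finset.mem_singleton] at h3 h4
        dsimp only at h3 h4
        exact Finset.disjoint_left.1 hd (hv ⟨i, R, hR⟩) (h3 ▸ h4 ▸ hv ⟨i, R', hR'⟩))
    (fun z => z.1.2)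
    (fun z => by
      funext s
      simp only [e, prod_disjSum, x, Sum.elim_inl, Sum.elim_inr, Pi.one_apply, prod_const_one,
        mul_one, Finset.prod_apply]
      by_cases hs : s < k
      · simp only [hs, dif_pos]
        rw [(hM z.1 _ z.2.2).2]
        by_cases hsz : (z.1 : ℕ) = s
        · subst hsz
          simp
        · rw [Pi.mulSingle_eq_of_ne (fun h => hsz (by rw [h])),
            Pi.mulSingle_eq_of_ne (fun h => hsz h.symm)]
      · rw [Pi.mulSingle_eq_of_ne (by have := z.1.2; omega)]
        simp [hs])
  rw [hcardV] at h
  have hι : (Fintype.card ι : ℝ) = ∑ i, (#(M i) : ℝ) := by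
    simp [ι]
  rw [hι] at h
  exact_mod_cast h

end Bounds

end LinearLDC

theorem theorem2p1 (q : ℕ) (hq : Odd q) (hq3 : 3 ≤ q) :
    ∃ C : ℝ, 0 < C ∧
      ∀ (k n : ℕ) (δ ε : ℝ) (E : (Fin k → ℤˣ) → (Fin n → ℤˣ)),
        2 ≤ n → 0 < δ → 0 < ε → IsLinearCode E → IsLDC q δ ε E →
          (k : ℝ) ≤ C / δ * (n : ℝ) ^ (1 - 2 / (q : ℝ)) * Real.log n ^ 2 := by
  have hl2 : 0 < Real.log 2 := Real.log_pos (by norm_num)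
  have hlq : 0 ≤ Real.log ((q : ℝ) + 1) :=
    Real.log_nonneg (by linarith [Nat.cast_nonneg (α := ℝ) q])
  have hq0 : (0 : ℝ) < q := by exact_mod_cast (by omega : 0 < q)
  set C₁ : ℝ := 2 * (q * (128 * 2 ^ q * q) + 2) / Real.log 2 ^ 2 with hC₁
  have hC₁0 : 0 < C₁ := by positivity
  set L : ℝ := Real.log ((q : ℝ) + 1) / Real.log 2 + 1 with hL
  have hL0 : 0 < L := by positivity
  -- The factor q comes from the matching size, each q + 1 from replacing n by (q+1)n, and L from
  -- log((q+1)n) ≤ L log n.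
  refine ⟨C₁ * q * (q + 1) * (q + 1) * L ^ 2, by positivity, ?_⟩
  intro k n δ ε E hn hδ hε hE hLDC
  have hnR : (2 : ℝ) ≤ n := by exact_mod_cast hn
  have hn0 : (0 : ℝ) < n := by linarith
  choose M hM hdis hcard using fun i => exists_matching_of_isLDC hε hE hLDC i
  have hkn : k ≤ n := by
    refine le_of_forall_isRecoverySet (E := E) fun i => ?_
    have h1 : 0 < (q : ℝ) * (M i).card := (mul_pos hδ hn0).trans_le (hcard i)
    have h2 : (0 : ℝ) < (M i).card := pos_of_mul_pos_right h1 hq0.le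
    obtain ⟨R, hR⟩ := Finset.card_pos.1 (by exact_mod_cast h2 : 0 < (M i).card)
    exact ⟨R, (hM i R hR).2⟩
  have hsum := sum_card_matchings_le hq3 hn hkn M hM hdis
  have hlow : (k : ℝ) * (δ * n) ≤ q * ∑ i, ((M i).card : ℝ) := by
    rw [Finset.mul_sum]
    have := Finset.card_nsmul_le_sum Finset.univ
      (fun i => (q : ℝ) * (M i).card) (δ * n) fun i _ => hcard i
    simpa using this
  have hexp0 : 0 ≤ 1 - 2 / (q : ℝ) := by
    rw [sub_nonneg, div_le_one hq0]
    exact_mod_cast (by omega : 2 ≤ q)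
  have hexp1 : 1 - 2 / (q : ℝ) ≤ 1 := by
    have : 0 ≤ 2 / (q : ℝ) := by positivity
    linarith
  have hpow : ((q + 1) * n : ℝ) ^ (1 - 2 / (q : ℝ)) ≤ (q + 1) * (n : ℝ) ^ (1 - 2 / (q : ℝ)) := by
    rw [Real.mul_rpow (by positivity) hn0.le]
    refine mul_le_mul_of_nonneg_right ?_ (by positivity)
    calc ((q : ℝ) + 1) ^ (1 - 2 / (q : ℝ)) ≤ ((q : ℝ) + 1) ^ (1 : ℝ) :=
          Real.rpow_le_rpow_of_exponent_le (by linarith) hexp1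
      _ = q + 1 := Real.rpow_one _
  have hln : Real.log 2 ≤ Real.log n := Real.log_le_log (by norm_num) hnR
  have hlog : Real.log ((q + 1) * n : ℝ) ≤ L * Real.log n := by
    rw [Real.log_mul (by positivity) hn0.ne', hL, add_mul, one_mul, div_mul_eq_mul_div,
      mul_div_assoc]
    have : 1 ≤ Real.log n / Real.log 2 := (one_le_div hl2).2 hln
    linarith [le_mul_of_one_le_right hlq this]
  have hlog0 : 0 ≤ Real.log ((q + 1) * n : ℝ) := Real.log_nonneg (by nlinarith)
  have hfin : (k : ℝ) * δ * n ≤ (C₁ * q * (q + 1) * (q + 1) * L ^ 2 *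
      (n : ℝ) ^ (1 - 2 / (q : ℝ)) * Real.log n ^ 2) * n := by
    calc (k : ℝ) * δ * n = k * (δ * n) := by ring
      _ ≤ q * (C₁ * ((q + 1) * n) * ((q + 1) * n : ℝ) ^ (1 - 2 / (q : ℝ)) *
          Real.log ((q + 1) * n : ℝ) ^ 2) :=
          hlow.trans (mul_le_mul_of_nonneg_left hsum hq0.le)
      _ ≤ q * (C₁ * ((q + 1) * n) * ((q + 1) * (n : ℝ) ^ (1 - 2 / (q : ℝ))) *
          (L * Real.log n) ^ 2) := by gcongr
      _ = _ := by ring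
  have hkδ := le_of_mul_le_mul_right hfin hn0
  rw [div_mul_eq_mul_div, div_mul_eq_mul_div, le_div_iff₀ hδ]
  exact hkδ
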